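/- **Setting.** Write $\mathbb D$ for the closed Euclidean unit ball (of $\mathbb R^n$ or $\mathbb R^{2n}$), $A_*=A\setminus\{0\}$, and $\pi_J(x)=\sum_{j\in J}x_je_j$ for $J\subseteq\{1,\dots,n\}$. For a Borel measure $\nu$ on $\mathbb R^n_*$, let $\nu_J$ be the image of $\nu$ under $\pi_J$, restricted to $\mathbb R^n_*$. A Lévy process has independent stationary increments, starts at $0$, and has càdlàg paths, almost surely. Write $X\sim L^n(\mu,\Sigma,\nu)$ if $X$ is a Lévy process in $\mathbb R^n$ with $\mathbb E\,e^{i\langle\theta,X(t)\rangle}=e^{t\Psi(\theta)}$ for all $t\ge 0$, $\theta\in\mathbb R^n$, where $$\Psi(\theta)=i\langle\mu,\theta\rangle-\tfrac12\,\theta\Sigma\theta'+\int_{\mathbb R^n_*}\big(e^{i\langle\theta,x\rangle}-1-i\langle\theta,x\rangle\mathbf 1_{\mathbb D}(x)\big)\,\nu(dx),$$ $\Sigma$ is a covariance matrix, and $\nu$ is a Lévy measure, that is, $\int_{\mathbb R^n_*}(\|x\|^2\wedge1)\,\nu(dx)<\infty$. Write $T\sim S^n(d,\mathcal T)$ if $T$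 is a subordinator, i.e. a Lévy process in $\mathbb R^n$ with nondecreasing components, with drift $d\in[0,\infty)^n$ and Lévy measure $\mathcal T$ on $[0,\infty)^n_*$; thus $\int_{\mathbb D_*}\|x\|\,\mathcal T(dx)<\infty$ and $T\sim L^n\big(d+\int_{\mathbb D_*}x\,\mathcal T(dx),0,\mathcal T\big)$. For $t\in[0,\infty)^n$ put $X(t)=(X_1(t_1),\dots,X_n(t_n))$. Let $t_{(1)}\le\dots\le t_{(n)}$ be the ordered components of $t$ (with $(\cdot)$ the associated permutation), $t_{(0)}=0$, $\Delta t_{(k)}=t_{(k)}-t_{(k-1)}$ and $J_k=\{(k),\dots,(n)\}$. Define $$t\diamond\mu=(t_1\mu_1,\dots,t_n\mu_n),\qquad (t\diamond\Sigma)_{kl}=\Sigma_{kl}\,(t_k\wedge t_l),\qquad t\diamond\nu=\sum_{k=1}^n\Delta t_{(k)}\,\nu_{J_k},$$ $$c(t,\nu)=\sum_{k=2}^n\Delta t_{(k)}\int_{\mathbb D^C}\pi_{J_k}(x)\,\mathbf 1_{\mathbb D}(\pi_{J_k}(x))\,\nu(dx).$$ **Weak and semi-strong subordination.** Let $X\sim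 L^n(\mu,\Sigma,\nu)$ and $T\sim S^n(d,\mathcal T)$. A process $Z$ in $\mathbb R^{2n}$ is *$T$ subordinating $X$ in the weak sense*, written $Z\overset{\mathcal D}{=}(T,X\odot T)$, if $Z\sim L^{2n}(m,\Theta,\mathcal Z)$ with $m=(m_1,m_2)$ and $$m_1=d+\int_{[0,\infty)^n_*}t\;\mathbb P\big((t,X(t))\in\mathbb D\big)\,\mathcal T(dt),$$ $$m_2=c(d,\nu)+d\diamond\mu+\int_{[0,\infty)^n_*}\mathbb E\big[X(t)\,\mathbf 1_{\mathbb D}(t,X(t))\big]\,\mathcal T(dt),$$ $$\Theta=\begin{pmatrix}0&0\\0&d\diamond\Sigma\end{pmatrix},\qquad \mathcal Z(dt,dx)=\big(\delta_0\otimes(d\diamond\nu)\big)(dt,dx)+\mathbf 1_{[0,\infty)^n_*\times\mathbb R^n}(t,x)\,\mathbb P(X(t)\in dx)\,\mathcal T(dt).$$ A process $Z=(Z_1,Z_2)$ is *$T$ subordinating $X$ in the semi-strong sense* if $Z_1$ and $T$ are indistinguishable and $Z\overset{\mathcal D}{=}(T,X\odot T)$ in the weak sense. **Proposition 3.3.**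 Let $X\sim L^n(\mu,\Sigma,\nu)$ and $T\sim S^n(d,\mathcal T)$ be independent processes on a probability space, and let $(X\circ T)(t)=(X_1(T_1(t)),\dots,X_n(T_n(t)))$ for $t\ge0$. If the components $T_1,\dots,T_n$ of $T$ are indistinguishable, or the components $X_1,\dots,X_n$ of $X$ are independent processes, then $(T,X\circ T)$ is $T$ subordinating $X$ in the semi-strong sense; that is, $(T,X\circ T)\overset{\mathcal D}{=}(T,X\odot T)$ in the semi-strong sense. In particular, $(T,X\circ T)$ is a Lévy process in $\mathbb R^{2n}$. -/

import Mathlib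

open MeasureTheory ProbabilityTheory Filter
open scoped NNReal ENNReal Topology

namespace WeakSubordination

noncomputable section

/-! ### Lévy processes and their canonical triplets -/

/-- `ℝ^ι` with the Euclidean norm. -/
abbrev E (ι : Type*) : Type _ := EuclideanSpace ℝ ι

/-- The closed Euclidean unit ball centred at the origin. -/
def unitBall (ι : Type*) [Fintype ι] : Set (E ι) := {x | ‖x‖ ≤ 1}

/-- A path `[0,∞) → F` that is right-continuous and has left limits. -/
def IsCadlagPath {F : Type*} [TopologicalSpace F] (f : ℝ≥0 → F) : Prop :=
  ∀ t, ContinuousWithinAt f (Set.Ici t) t ∧ ∃ l, Tendsto f (𝓝[<] t) (𝓝 l)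

/-- A Lévy process: it starts at `0` almost surely, has independent and stationary increments, and
almost surely has càdlàg paths. -/
structure IsLevyProcess {ι Ω : Type*} [Fintype ι] {mΩ : MeasurableSpace Ω}
    (X : ℝ≥0 → Ω → E ι) (P : Measure Ω) : Prop where
  aemeasurable : ∀ t, AEMeasurable (X t) P
  zero : ∀ᵐ ω ∂P, X 0 ω = 0
  indep : HasIndepIncrements X P
  stationary : ∀ s t, IdentDistrib (fun ω => X (s + t) ω - X s ω) (X t) P P
  cadlag : ∀ᵐ ω ∂P, IsCadlagPath fun t => X t ω

/-- A Lévy measure. Borel measures on `ℝ^ι ∖ {0}` are represented as Borel measures on `ℝ^ι` that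
do not charge the origin. -/
structure IsLevyMeasure {ι : Type*} [Fintype ι] (ν : Measure (E ι)) : Prop where
  zero : ν {0} = 0
  finite : ∫⁻ x, ENNReal.ofReal (min (‖x‖ ^ 2) 1) ∂ν < ∞

/-- The Lévy exponent
`Ψ(θ) = i⟨μ,θ⟩ - ½ θ S θ' + ∫ (e^{i⟨θ,x⟩} - 1 - i⟨θ,x⟩ 1_𝔻(x)) ν(dx)`. -/
def levyExponent {ι : Type*} [Fintype ι] (μ : E ι) (S : Matrix ι ι ℝ) (ν : Measure (E ι))
    (θ : E ι) : ℂ :=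
  Complex.I * (inner ℝ μ θ : ℝ) - ((1 / 2 * ∑ k, ∑ l, θ k * S k l * θ l : ℝ) : ℂ)
    + ∫ x, (Complex.exp (Complex.I * (inner ℝ θ x : ℝ)) - 1
        - Complex.I * (((unitBall ι).indicator (fun y => inner ℝ θ y) x : ℝ) : ℂ)) ∂ν

/-- `X ∼ L(μ, S, ν)`: `X` is a Lévy process with canonical triplet `(μ, S, ν)`. -/
structure HasTriplet {ι Ω : Type*} [Fintype ι] {mΩ : MeasurableSpace Ω}
    (X : ℝ≥0 → Ω → E ι) (P : Measure Ω)
    (μ : E ι) (S : Matrix ι ι ℝ) (ν : Measure (E ι)) : Prop where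
  levy : IsLevyProcess X P
  cov : S.PosSemidef
  levyMeasure : IsLevyMeasure ν
  charFun_eq : ∀ (t : ℝ≥0) (θ : E ι),
    charFun (P.map (X t)) θ = Complex.exp ((t : ℝ) * levyExponent μ S ν θ)

/-- `T ∼ S(d, τ)`: `T` is a subordinator (a Lévy process with nondecreasing components) with drift
`d ∈ [0,∞)^ι` and Lévy measure `τ` on `[0,∞)^ι ∖ {0}`. It has finite variation: there is no Gaussian
part, `∫_𝔻 ‖x‖ τ(dx) < ∞`, and the drift is the first characteristic minus `∫_𝔻 x τ(dx)`. -/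
structure IsSubordinator {ι Ω : Type*} [Fintype ι] {mΩ : MeasurableSpace Ω}
    (T : ℝ≥0 → Ω → E ι) (P : Measure Ω) (d : E ι) (τ : Measure (E ι)) : Prop where
  triplet : HasTriplet T P (d + ∫ x in unitBall ι, x ∂τ) 0 τ
  finiteVariation : ∫⁻ x in unitBall ι, ENNReal.ofReal ‖x‖ ∂τ < ∞
  nondecreasing : ∀ᵐ ω ∂P, ∀ k, Monotone fun t => T t ω k
  drift_nonneg : ∀ k, 0 ≤ d k
  orthant : τ {x | ∀ k, 0 ≤ x k}ᶜ = 0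

/-! ### Multivariate time -/

/-- `X(t) = (X₁(t₁), …, Xₙ(tₙ))` for `t ∈ [0,∞)^ι`. -/
def multiEval {ι Ω : Type*} (X : ℝ≥0 → Ω → E ι) (t : E ι) (ω : Ω) : E ι :=
  WithLp.toLp 2 fun k => X (t k).toNNReal ω k

/-- The traditionally subordinated process `(X ∘ T)(t) = (X₁(T₁(t)), …, Xₙ(Tₙ(t)))`. -/
def subordinate {ι Ω : Type*} (X T : ℝ≥0 → Ω → E ι) (t : ℝ≥0) (ω : Ω) : E ι :=
  multiEval X (T t ω) ω

/-- The projection `π_J(x) = ∑_{j ∈ J} x_j e_j`. -/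
def proj {ι : Type*} [DecidableEq ι] (J : Finset ι) (x : E ι) : E ι :=
  WithLp.toLp 2 fun k => if k ∈ J then x k else 0

/-- The image `ν_J` of `ν` under `π_J`, restricted to `ℝ^ι ∖ {0}`. -/
def projMeasure {ι : Type*} [Fintype ι] [DecidableEq ι] (J : Finset ι) (ν : Measure (E ι)) :
    Measure (E ι) :=
  (ν.map (proj J)).restrict {0}ᶜ

/-- The spacing `Δt_(k) = t_(k) - t_(k-1)` of the ordered components `t_(1) ≤ … ≤ t_(n)` of `t`,
where `t_(0) = 0`; positions are counted from `0` here. -/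
def spacing {n : ℕ} (t : E (Fin n)) (k : Fin n) : ℝ :=
  t (Tuple.sort (fun i => t i) k) -
    if (k : ℕ) = 0 then 0
    else t (Tuple.sort (fun i => t i) ⟨(k : ℕ) - 1, lt_of_le_of_lt (Nat.sub_le _ _) k.isLt⟩)

/-- The index set `{(k), …, (n)}` of the components of `t` at the positions from `k` on. -/
def upper {n : ℕ} (t : E (Fin n)) (k : Fin n) : Finset (Fin n) :=
  Finset.univ.filter fun j => k ≤ (Tuple.sort (fun i => t i)).symm j

/-- `t ⋄ μ = (t₁ μ₁, …, tₙ μₙ)`. -/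
def diamondVec {n : ℕ} (t μ : E (Fin n)) : E (Fin n) :=
  WithLp.toLp 2 fun k => t k * μ k

/-- `(t ⋄ S)_{kl} = S_{kl} (t_k ∧ t_l)`. -/
def diamondMat {n : ℕ} (t : E (Fin n)) (S : Matrix (Fin n) (Fin n) ℝ) :
    Matrix (Fin n) (Fin n) ℝ :=
  Matrix.of fun k l => S k l * min (t k) (t l)

/-- `t ⋄ ν = ∑_k Δt_(k) ν_{{(k), …, (n)}}`. -/
def diamondMeasure {n : ℕ} (t : E (Fin n)) (ν : Measure (E (Fin n))) : Measure (E (Fin n)) :=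
  ∑ k, ENNReal.ofReal (spacing t k) • projMeasure (upper t k) ν

/-- The compensation term
`c(t, ν) = ∑_{k ≥ 2} Δt_(k) ∫_{𝔻ᶜ} π_{{(k), …, (n)}}(x) 1_𝔻(π_{{(k), …, (n)}}(x)) ν(dx)`. -/
def compensation {n : ℕ} (t : E (Fin n)) (ν : Measure (E (Fin n))) : E (Fin n) :=
  ∑ k ∈ Finset.univ.filter (fun k : Fin n => 0 < (k : ℕ)),
    spacing t k •
      ∫ x in (unitBall (Fin n))ᶜ,
        (unitBall (Fin n)).indicator (fun y => y) (proj (upper t k) x) ∂ν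

/-! ### Weak and semi-strong subordination -/

/-- The vector `(t, x) ∈ ℝ^{2n}`. -/
def pair {ι : Type*} (t x : E ι) : E (ι ⊕ ι) :=
  WithLp.toLp 2 (Sum.elim (fun k => t k) (fun k => x k))

/-- `[0,∞)^ι ∖ {0}`. -/
def puncturedOrthant (ι : Type*) : Set (E ι) := {t | (∀ k, 0 ≤ t k) ∧ t ≠ 0}

/-- The law of `(t, X(t))`. -/
def pairLaw {ι Ω : Type*} [Fintype ι] {mΩ : MeasurableSpace Ω}
    (X : ℝ≥0 → Ω → E ι) (P : Measure Ω) (t : E ι) : Measure (E (ι ⊕ ι)) :=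
  P.map fun ω => pair t (multiEval X t ω)

/-- `m₁ = d + ∫ t ℙ((t, X(t)) ∈ 𝔻) τ(dt)`. -/
def weakMeanTime {n : ℕ} {Ω : Type*} {mΩ : MeasurableSpace Ω}
    (X : ℝ≥0 → Ω → E (Fin n)) (P : Measure Ω) (d : E (Fin n)) (τ : Measure (E (Fin n))) :
    E (Fin n) :=
  d + ∫ t in puncturedOrthant (Fin n), (pairLaw X P t).real (unitBall (Fin n ⊕ Fin n)) • t ∂τ

/-- `m₂ = c(d, ν) + d ⋄ μ + ∫ 𝔼[X(t) 1_𝔻(t, X(t))] τ(dt)`. -/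
def weakMeanSpace {n : ℕ} {Ω : Type*} {mΩ : MeasurableSpace Ω}
    (X : ℝ≥0 → Ω → E (Fin n)) (P : Measure Ω) (μ : E (Fin n)) (ν : Measure (E (Fin n)))
    (d : E (Fin n)) (τ : Measure (E (Fin n))) : E (Fin n) :=
  compensation d ν + diamondVec d μ +
    ∫ t in puncturedOrthant (Fin n),
      (∫ ω, {ω' | pair t (multiEval X t ω') ∈ unitBall (Fin n ⊕ Fin n)}.indicator
        (multiEval X t) ω ∂P) ∂τ

/-- `δ₀(dt) ⊗ (d ⋄ ν)(dx) + 1_{[0,∞)ⁿ∖{0} × ℝⁿ}(t, x) ℙ(X(t) ∈ dx) τ(dt)`. -/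
def weakLevyMeasure {n : ℕ} {Ω : Type*} {mΩ : MeasurableSpace Ω}
    (X : ℝ≥0 → Ω → E (Fin n)) (P : Measure Ω) (ν : Measure (E (Fin n)))
    (d : E (Fin n)) (τ : Measure (E (Fin n))) : Measure (E (Fin n ⊕ Fin n)) :=
  (diamondMeasure d ν).map (pair 0) +
    (τ.restrict (puncturedOrthant (Fin n))).bind (pairLaw X P)

/-- For `X ∼ L(μ, S, ν)` under `P` and a subordinator `T ∼ S(d, τ)`: the process `Z` under `Q` is
`T` subordinating `X` in the weak sense, in symbols `Z =ᵈ (T, X ⊙ T)`. -/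
def IsWeakSubordination {n : ℕ} {Ω Ω' : Type*} {mΩ : MeasurableSpace Ω} {mΩ' : MeasurableSpace Ω'}
    (Z : ℝ≥0 → Ω' → E (Fin n ⊕ Fin n)) (Q : Measure Ω')
    (X : ℝ≥0 → Ω → E (Fin n)) (P : Measure Ω)
    (μ : E (Fin n)) (S : Matrix (Fin n) (Fin n) ℝ) (ν : Measure (E (Fin n)))
    (d : E (Fin n)) (τ : Measure (E (Fin n))) : Prop :=
  HasTriplet Z Q (pair (weakMeanTime X P d τ) (weakMeanSpace X P μ ν d τ))
    (Matrix.fromBlocks 0 0 0 (diamondMat d S)) (weakLevyMeasure X P ν d τ)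

/-- `Z = (Z₁, Z₂)` is `T` subordinating `X` in the semi-strong sense: `Z₁` and `T` are
indistinguishable and `Z =ᵈ (T, X ⊙ T)` in the weak sense. -/
def IsSemiStrongSubordination {n : ℕ} {Ω Ω' : Type*}
    {mΩ : MeasurableSpace Ω} {mΩ' : MeasurableSpace Ω'}
    (Z : ℝ≥0 → Ω' → E (Fin n ⊕ Fin n)) (T : ℝ≥0 → Ω' → E (Fin n)) (Q : Measure Ω')
    (X : ℝ≥0 → Ω → E (Fin n)) (P : Measure Ω)
    (μ : E (Fin n)) (S : Matrix (Fin n) (Fin n) ℝ) (ν : Measure (E (Fin n)))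
    (d : E (Fin n)) (τ : Measure (E (Fin n))) : Prop :=
  (∀ᵐ ω ∂Q, ∀ t k, Z t ω (Sum.inl k) = T t ω k) ∧ IsWeakSubordination Z Q X P μ S ν d τ

/-! ### The two cases of traditional subordination -/

/-- The components `T₁, …, Tₙ` are indistinguishable processes. -/
def HasIndistinguishableComponents {ι Ω : Type*} {mΩ : MeasurableSpace Ω}
    (T : ℝ≥0 → Ω → E ι) (P : Measure Ω) : Prop :=
  ∀ᵐ ω ∂P, ∀ t k l, T t ω k = T t ω l

/-- The components `X₁, …, Xₙ` are independent processes. -/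
def HasIndependentComponents {ι Ω : Type*} {mΩ : MeasurableSpace Ω}
    (X : ℝ≥0 → Ω → E ι) (P : Measure Ω) : Prop :=
  iIndepFun (fun k ω (t : ℝ≥0) => X t ω k) P

end

end WeakSubordination

/-!
Fix an increasing chain of times and condition on the values `s₀ ≤ s₁ ≤ …` that `T` takes along it.
For a frozen chain in `[0,∞)ⁿ`, the increments `X(s_{j+1}) - X(s_j)` are independent, and the
exponent of `⟨θ, X(s)⟩` is a *linear* function `s ↦ ∑ₖ u(θ)ₖ sₖ` with `Re u(θ)ₖ ≤ 0`, under either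
hypothesis: on the diagonal because `X` is observed at a single time
(`HasTriplet.hasLinearExponent_diagonal`), and for independent components because the exponent
splits over the coordinates (`HasTriplet.hasLinearExponent_orthant`). For general `X` and `T` the
exponent is only piecewise linear in `s`, and `(T, X ∘ T)` need not be a Lévy process.

Linearity turns the conditional characteristic function into a product of exponentials of linear
functions of the increments of `T`. These are independent and stationary, so `(T, X ∘ T)` has
independent stationary increments, with exponent the Laplace exponent of `T` at the complex vector
`iθ₁ + u(θ₂)` (`IsLinearTimeChange.isLevyProcess_pair`). The Lévy–Khintchine formula gives the
Laplace exponent of `T` only at imaginary vectors. It extends to vectors with nonpositive real part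
since both sides are holomorphic and bounded on a half-plane and agree on its boundary
(`IsSubordinator.integral_exp`).

It remains to read off the triplet. The drift part of the Laplace exponent is
`∑ₖ u(θ₂)ₖ dₖ = ∑ₖ Δd_(k) Ψ(π_{J_k} θ₂)`, the exponent of the triplet
`(c(d,ν) + d⋄μ, d⋄S, d⋄ν)` (`levyExponent_diamond`). The jump part is the integral over `τ` of the
characteristic function of `(t, X(t))` minus `1`; splitting off the truncated first moments leaves
the compensated integral over the second part of the weak Lévy measure. The integrals
converge because the truncated first and second moments of `X(t)` are `O(‖t‖)` as `t → 0`
(`HasTriplet.exists_integral_min_norm_pair_le`,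
`HasTriplet.exists_norm_integral_truncatedEval_le`). In the diagonal case the drift and the jumps
of `T` have to lie on the diagonal as well (`IsSubordinator.diagonal`).

The argument needs joint measurability in time and randomness, so that `X` and `T` are replaced by
indistinguishable measurable processes all of whose paths are càdlàg
(`exists_indistinguishable_cadlag`).
-/

namespace WeakSubordination

noncomputable section

/-! ### The Lévy exponent -/

section Exponent

variable {ι : Type*} [Fintype ι]

/-- The integrand `e^{i⟨θ,x⟩} - 1 - i⟨θ,x⟩ 1_𝔻(x)` of the Lévy exponent. -/
def levyIntegrand (θ x : E ι) : ℂ :=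
  Complex.exp (Complex.I * (inner ℝ θ x : ℝ)) - 1
    - Complex.I * (((unitBall ι).indicator (fun y => inner ℝ θ y) x : ℝ) : ℂ)

lemma measurableSet_unitBall : MeasurableSet (unitBall ι) :=
  measurableSet_le measurable_norm measurable_const

lemma norm_exp_I_mul_ofReal_le_one (y : ℝ) : ‖Complex.exp (Complex.I * y)‖ ≤ 1 := by
  rw [mul_comm, Complex.norm_exp_ofReal_mul_I]

lemma norm_exp_I_mul_sub_one_sub_le (y : ℝ) :
    ‖Complex.exp (Complex.I * y) - 1 - Complex.I * y‖ ≤ 3 * y ^ 2 := by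
  have hn : ‖Complex.I * (y : ℂ)‖ = |y| := by simp
  rcases le_total |y| 1 with h | h
  · have := Complex.norm_exp_sub_one_sub_id_le (x := Complex.I * y) (by rw [hn]; exact h)
    rw [hn, sq_abs] at this
    nlinarith [sq_nonneg y]
  · have h1 := norm_sub_le (Complex.exp (Complex.I * y) - 1) (Complex.I * y)
    have h2 := norm_sub_le (Complex.exp (Complex.I * y)) 1
    have h3 := norm_exp_I_mul_ofReal_le_one y
    rw [hn] at h1
    rw [norm_one] at h2
    nlinarith [sq_abs y]

lemma norm_levyIntegrand_le (θ x : E ι) :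
    ‖levyIntegrand θ x‖ ≤ 3 * (1 + ‖θ‖ ^ 2) * min (‖x‖ ^ 2) 1 := by
  unfold levyIntegrand
  by_cases hx : x ∈ unitBall ι
  · rw [Set.indicator_of_mem hx]
    have hx1 : ‖x‖ ≤ 1 := hx
    rw [min_eq_left (by nlinarith [norm_nonneg x])]
    refine (norm_exp_I_mul_sub_one_sub_le _).trans ?_
    have h1 := abs_real_inner_le_norm θ x
    have h2 : (inner ℝ θ x : ℝ) ^ 2 ≤ (‖θ‖ * ‖x‖) ^ 2 := sq_le_sq' (by
      linarith [neg_abs_le (inner ℝ θ x : ℝ)]) ((le_abs_self _).trans h1)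
    nlinarith [sq_nonneg ‖x‖]
  · rw [Set.indicator_of_notMem hx]
    have hx1 : 1 < ‖x‖ := not_le.1 hx
    rw [min_eq_right (by nlinarith)]
    have h2 := norm_sub_le (Complex.exp (Complex.I * (inner ℝ θ x : ℝ))) 1
    have h3 := norm_exp_I_mul_ofReal_le_one (inner ℝ θ x : ℝ)
    rw [norm_one] at h2
    simp only [Complex.ofReal_zero, mul_zero, sub_zero]
    nlinarith [sq_nonneg ‖θ‖]

@[fun_prop]
lemma measurable_levyIntegrand (θ : E ι) : Measurable (levyIntegrand θ) := by
  unfold levyIntegrand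
  have h : Measurable ((unitBall ι).indicator (fun y => (inner ℝ θ y : ℝ))) :=
    Measurable.indicator (by fun_prop) measurableSet_unitBall
  fun_prop

@[simp]
lemma levyIntegrand_zero_right (θ : E ι) : levyIntegrand θ 0 = 0 := by
  unfold levyIntegrand
  by_cases h : (0 : E ι) ∈ unitBall ι <;> simp [Set.indicator, h]

lemma IsLevyMeasure.integrable_min {ν : Measure (E ι)} (hν : IsLevyMeasure ν) :
    Integrable (fun x => min (‖x‖ ^ 2) 1) ν := by
  refine ⟨by fun_prop, ?_⟩
  rw [hasFiniteIntegral_iff_ofReal (ae_of_all _ fun x => by positivity)]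
  exact hν.finite

lemma IsLevyMeasure.of_integrable {ν : Measure (E ι)} (h0 : ν {0} = 0)
    (h : Integrable (fun x => min (‖x‖ ^ 2) 1) ν) : IsLevyMeasure ν := by
  refine ⟨h0, ?_⟩
  have := h.2
  rwa [hasFiniteIntegral_iff_ofReal (ae_of_all _ fun x => by positivity)] at this

lemma IsLevyMeasure.integrable_levyIntegrand {ν : Measure (E ι)} (hν : IsLevyMeasure ν)
    (θ : E ι) : Integrable (levyIntegrand θ) ν :=
  (hν.integrable_min.const_mul (3 * (1 + ‖θ‖ ^ 2))).mono'
    (measurable_levyIntegrand θ).aestronglyMeasurable (ae_of_all _ (norm_levyIntegrand_le θ))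

lemma levyExponent_eq (μ : E ι) (S : Matrix ι ι ℝ) (ν : Measure (E ι)) (θ : E ι) :
    levyExponent μ S ν θ = Complex.I * (inner ℝ μ θ : ℝ)
      - ((1 / 2 * ∑ k, ∑ l, θ k * S k l * θ l : ℝ) : ℂ) + ∫ x, levyIntegrand θ x ∂ν := rfl

lemma abs_apply_le_norm (θ : E ι) (k : ι) : |θ k| ≤ ‖θ‖ := by
  simpa using PiLp.norm_apply_le θ k

/-- The Lévy exponent grows at most quadratically. -/
lemma exists_norm_levyExponent_le (μ : E ι) (S : Matrix ι ι ℝ) {ν : Measure (E ι)}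
    (hν : IsLevyMeasure ν) :
    ∃ C, 0 ≤ C ∧ ∀ θ, ‖levyExponent μ S ν θ‖ ≤ C * (1 + ‖θ‖ ^ 2) := by
  refine ⟨‖μ‖ + ∑ k, ∑ l, |S k l| + 3 * ∫ x, min (‖x‖ ^ 2) 1 ∂ν, ?_, fun θ => ?_⟩
  · have : 0 ≤ ∫ x, min (‖x‖ ^ 2) 1 ∂ν := integral_nonneg fun x => by positivity
    positivity
  have h1 : ‖Complex.I * ((inner ℝ μ θ : ℝ) : ℂ)‖ ≤ ‖μ‖ * (1 + ‖θ‖ ^ 2) := by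
    rw [norm_mul, Complex.norm_I, one_mul, Complex.norm_real, Real.norm_eq_abs]
    refine (abs_real_inner_le_norm μ θ).trans ?_
    gcongr
    nlinarith [sq_nonneg (‖θ‖ - 1), norm_nonneg θ]
  have h2 : ‖((1 / 2 * ∑ k, ∑ l, θ k * S k l * θ l : ℝ) : ℂ)‖
      ≤ (∑ k, ∑ l, |S k l|) * (1 + ‖θ‖ ^ 2) := by
    rw [Complex.norm_real, Real.norm_eq_abs, abs_mul]
    have h3 : |∑ k, ∑ l, θ k * S k l * θ l| ≤ (∑ k, ∑ l, |S k l|) * (1 + ‖θ‖ ^ 2) := by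
      rw [Finset.sum_mul]
      refine (Finset.abs_sum_le_sum_abs _ _).trans (Finset.sum_le_sum fun k _ => ?_)
      rw [Finset.sum_mul]
      refine (Finset.abs_sum_le_sum_abs _ _).trans (Finset.sum_le_sum fun l _ => ?_)
      rw [abs_mul, abs_mul]
      have ha := abs_apply_le_norm θ k
      have hb := abs_apply_le_norm θ l
      calc |θ k| * |S k l| * |θ l| = |S k l| * (|θ k| * |θ l|) := by ring
        _ ≤ |S k l| * (‖θ‖ * ‖θ‖) := by gcongr
        _ ≤ |S k l| * (1 + ‖θ‖ ^ 2) := by gcongr; nlinarith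
    rw [abs_of_pos (by norm_num : (0:ℝ) < 1 / 2)]
    linarith [abs_nonneg (∑ k, ∑ l, θ k * S k l * θ l)]
  have h3 : ‖∫ x, levyIntegrand θ x ∂ν‖
      ≤ 3 * (1 + ‖θ‖ ^ 2) * ∫ x, min (‖x‖ ^ 2) 1 ∂ν := by
    rw [← integral_const_mul]
    exact norm_integral_le_of_norm_le (hν.integrable_min.const_mul _)
      (ae_of_all _ (norm_levyIntegrand_le θ))
  rw [levyExponent_eq]
  calc _ ≤ _ + _ + _ := (norm_add_le _ _).trans (add_le_add_left (norm_sub_le _ _) _)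
    _ ≤ _ := add_le_add (add_le_add h1 h2) h3
    _ = _ := by ring

end Exponent

/-! ### Ordered spacings -/

section Spacing

variable {n : ℕ}

lemma sum_spacing_le (t : E (Fin n)) (p : Fin n) :
    ∑ j, (if j ≤ p then spacing t j else 0) = t (Tuple.sort (fun i => t i) p) := by
  classical
  set g : ℕ → ℝ := fun i => if h : i = 0 ∨ n < i then 0 else
    t (Tuple.sort (fun i => t i) ⟨i - 1, by omega⟩) with hg
  have h1 : ∀ j : Fin n, (if j ≤ p then spacing t j else 0)
      = (fun i : ℕ => if i ≤ (p : ℕ) then g (i + 1) - g i else 0) (j : ℕ) := by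
    intro j
    have hj := j.isLt
    have hn : ¬ n < (j : ℕ) := by omega
    have hn' : ¬ n < (j : ℕ) + 1 := by omega
    by_cases hjp : j ≤ p
    · have : (j : ℕ) ≤ p := hjp
      simp only [hjp, this, if_true, hg, spacing, hn, hn', or_false, Nat.add_one_ne_zero,
        dite_false, Nat.add_sub_cancel]
      by_cases h0 : (j : ℕ) = 0
      · rw [if_pos h0, dif_pos h0]
      · rw [if_neg h0, dif_neg h0]
    · have : ¬ (j : ℕ) ≤ p := hjp
      simp [hjp, this]
  rw [Finset.sum_congr rfl fun j _ => h1 j,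
    Fin.sum_univ_eq_sum_range (fun i : ℕ => if i ≤ (p : ℕ) then g (i + 1) - g i else 0),
    ← Finset.sum_filter]
  have h2 : (Finset.range n).filter (fun i => i ≤ (p : ℕ)) = Finset.range (p + 1) := by
    ext i
    have := p.isLt
    simp only [Finset.mem_filter, Finset.mem_range]
    omega
  rw [h2, Finset.sum_range_sub]
  have hp : ¬ n < (p : ℕ) + 1 := by have := p.isLt; omega
  simp [hg, hp]

/-- The spacings of the levels `j` whose upper set contains `k` telescope to `t_k`. -/
lemma sum_spacing_upper (t : E (Fin n)) (k : Fin n) :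
    ∑ j, (if k ∈ upper t j then spacing t j else 0) = t k := by
  simpa [upper] using sum_spacing_le t ((Tuple.sort (fun i => t i)).symm k)

lemma sum_spacing_upper_inter (t : E (Fin n)) (k l : Fin n) :
    ∑ j, (if k ∈ upper t j ∧ l ∈ upper t j then spacing t j else 0) = min (t k) (t l) := by
  set σ := Tuple.sort (fun i => t i) with hσ
  have hm : Monotone fun i => t (σ i) := Tuple.monotone_sort (fun i => t i)
  have h1 := sum_spacing_le t (min (σ.symm k) (σ.symm l))
  have h2 : ∀ j, (k ∈ upper t j ∧ l ∈ upper t j) ↔ j ≤ min (σ.symm k) (σ.symm l) := by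
    intro j; simp [upper, hσ]
  simp_rw [h2]
  rw [h1]
  have := hm.map_min (a := σ.symm k) (b := σ.symm l)
  simpa using this

lemma spacing_nonneg {t : E (Fin n)} (ht : ∀ k, 0 ≤ t k) (k : Fin n) : 0 ≤ spacing t k := by
  unfold spacing
  split_ifs with h
  · simpa using ht _
  · have hm : Monotone fun i => t (Tuple.sort (fun i => t i) i) :=
      Tuple.monotone_sort (fun i => t i)
    exact sub_nonneg.2 (hm (by rw [Fin.le_def]; simp))

lemma upper_of_val_eq_zero (t : E (Fin n)) {k : Fin n} (hk : (k : ℕ) = 0) :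
    upper t k = Finset.univ := by
  ext j
  simp only [upper, Finset.mem_filter, Finset.mem_univ, true_and, iff_true]
  rw [Fin.le_def, hk]
  exact Nat.zero_le _

/-- `t ⋄ S` is a Schur product of positive semidefinite matrices, as the kernel `t_k ∧ t_l` is a
nonnegative combination of the rank-one matrices of the upper sets. -/
lemma posSemidef_diamondMat {t : E (Fin n)} (ht : ∀ k, 0 ≤ t k) {S : Matrix (Fin n) (Fin n) ℝ}
    (hS : S.PosSemidef) : (diamondMat t S).PosSemidef := by
  have h1 : (Matrix.of fun k l : Fin n => min (t k) (t l)).PosSemidef := by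
    have h2 : (Matrix.of fun k l : Fin n => min (t k) (t l)) = ∑ j, spacing t j •
        Matrix.vecMulVec (fun k => if k ∈ upper t j then (1 : ℝ) else 0)
          (star fun k => if k ∈ upper t j then (1 : ℝ) else 0) := by
      ext k l
      rw [Matrix.sum_apply, Matrix.of_apply, ← sum_spacing_upper_inter]
      refine Finset.sum_congr rfl fun j _ => ?_
      by_cases h1 : k ∈ upper t j <;> by_cases h2 : l ∈ upper t j <;>
        simp [Matrix.vecMulVec_apply, h1, h2]
    rw [h2]
    exact Matrix.posSemidef_sum _ fun j _ =>
      (Matrix.posSemidef_vecMulVec_self_star _).smul (spacing_nonneg ht j)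
  exact hS.hadamard h1

end Spacing

/-! ### The triplet at a multivariate time -/

section Proj

variable {ι : Type*} [DecidableEq ι]

@[simp]
lemma proj_apply (J : Finset ι) (x : E ι) (k : ι) : proj J x k = if k ∈ J then x k else 0 := rfl

@[fun_prop]
lemma measurable_proj (J : Finset ι) : Measurable (proj J : E ι → E ι) := by
  unfold proj
  have h : ∀ k : ι, Measurable fun x : E ι => if k ∈ J then x k else 0 := by
    intro k; split_ifs <;> fun_prop
  have : Measurable fun (x : E ι) (k : ι) => if k ∈ J then x k else 0 := measurable_pi_lambda _ h
  exact (WithLp.measurable_toLp 2 _).comp this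

variable [Fintype ι]

lemma inner_proj_left (J : Finset ι) (x y : E ι) :
    (inner ℝ (proj J x) y : ℝ) = inner ℝ x (proj J y) := by
  simp only [PiLp.inner_apply, proj_apply]
  refine Finset.sum_congr rfl fun k _ => ?_
  split_ifs <;> simp

lemma norm_proj_le (J : Finset ι) (x : E ι) : ‖proj J x‖ ≤ ‖x‖ := by
  rw [EuclideanSpace.norm_eq, EuclideanSpace.norm_eq]
  refine Real.sqrt_le_sqrt (Finset.sum_le_sum fun k _ => ?_)
  rw [proj_apply]
  split_ifs
  · exact le_rfl
  · simp; positivity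

lemma proj_univ (x : E ι) : proj Finset.univ x = x := by ext k; simp

lemma integral_projMeasure (J : Finset ι) (ν : Measure (E ι)) (θ : E ι) :
    ∫ x, levyIntegrand θ x ∂(projMeasure J ν) = ∫ x, levyIntegrand θ (proj J x) ∂ν := by
  unfold projMeasure
  rw [setIntegral_eq_integral_of_forall_compl_eq_zero, integral_map (by fun_prop) (by fun_prop)]
  intro x hx
  simp only [Set.mem_compl_iff, Set.mem_singleton_iff, not_not] at hx
  simp [hx]

lemma isLevyMeasure_projMeasure (J : Finset ι) {ν : Measure (E ι)} (hν : IsLevyMeasure ν) :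
    IsLevyMeasure (projMeasure J ν) := by
  refine IsLevyMeasure.of_integrable ?_ ?_
  · rw [projMeasure, Measure.restrict_apply (measurableSet_singleton 0)]
    simp
  · refine Integrable.restrict ?_
    rw [integrable_map_measure (by fun_prop) (by fun_prop)]
    refine hν.integrable_min.mono (by fun_prop) (ae_of_all _ fun x => ?_)
    have := norm_proj_le J x
    simp only [Function.comp]
    rw [Real.norm_of_nonneg (by positivity), Real.norm_of_nonneg (by positivity)]
    gcongr

/-- The integral of `π_J(x)` over the jumps `x` outside of the unit ball whose projection lies
inside. -/
def projDrift (J : Finset ι) (ν : Measure (E ι)) : E ι :=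
  ∫ x in (unitBall ι)ᶜ, (unitBall ι).indicator (fun y => y) (proj J x) ∂ν

lemma integrableOn_projDrift (J : Finset ι) {ν : Measure (E ι)} (hν : IsLevyMeasure ν) :
    IntegrableOn (fun x => (unitBall ι).indicator (fun y => y) (proj J x)) (unitBall ι)ᶜ ν := by
  have hm : Measurable ((unitBall ι).indicator (fun y : E ι => y)) :=
    measurable_id.indicator measurableSet_unitBall
  refine Integrable.mono' (hν.integrable_min.restrict (s := (unitBall ι)ᶜ))
    (hm.comp (measurable_proj J)).aestronglyMeasurable ?_
  refine (ae_restrict_iff' measurableSet_unitBall.compl).2 (ae_of_all _ fun x hx => ?_)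
  have hx1 : 1 < ‖x‖ := not_le.1 hx
  rw [min_eq_right (by nlinarith)]
  by_cases h : proj J x ∈ unitBall ι
  · rw [Set.indicator_of_mem h]; exact h
  · rw [Set.indicator_of_notMem h]; simp

/-- Projecting the argument of a Lévy exponent projects its triplet; the truncation has to be
corrected for the jumps whose projection enters the unit ball. -/
lemma levyExponent_proj (μ : E ι) (S : Matrix ι ι ℝ) {ν : Measure (E ι)} (hν : IsLevyMeasure ν)
    (J : Finset ι) (θ : E ι) :
    levyExponent μ S ν (proj J θ) = Complex.I * ((inner ℝ (proj J μ + projDrift J ν) θ : ℝ) : ℂ)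
      - ((1 / 2 * ∑ k, ∑ l, θ k * (if k ∈ J ∧ l ∈ J then S k l else 0) * θ l : ℝ) : ℂ)
      + ∫ x, levyIntegrand θ x ∂(projMeasure J ν) := by
  have hint : Integrable (fun x => levyIntegrand θ (proj J x)) ν := by
    refine (hν.integrable_min.const_mul (3 * (1 + ‖θ‖ ^ 2))).mono'
      ((measurable_levyIntegrand θ).comp (measurable_proj J)).aestronglyMeasurable
      (ae_of_all _ fun x => (norm_levyIntegrand_le θ _).trans ?_)
    have := norm_proj_le J x
    gcongr
  have hd := integrableOn_projDrift J hν
  have hdi : ((inner ℝ (projDrift J ν) θ : ℝ) : ℂ) = ∫ x, (unitBall ι)ᶜ.indicator (fun x =>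
      ((inner ℝ θ ((unitBall ι).indicator (fun y => y) (proj J x)) : ℝ) : ℂ)) x ∂ν := by
    rw [integral_indicator measurableSet_unitBall.compl, integral_complex_ofReal,
      integral_inner hd, real_inner_comm]
    rfl
  have hint2 : Integrable ((unitBall ι)ᶜ.indicator (fun x =>
      ((inner ℝ θ ((unitBall ι).indicator (fun y => y) (proj J x)) : ℝ) : ℂ))) ν := by
    rw [integrable_indicator_iff measurableSet_unitBall.compl]
    exact (hd.const_inner θ).ofReal
  have key : ∀ x, levyIntegrand (proj J θ) x = levyIntegrand θ (proj J x) + Complex.I *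
      (unitBall ι)ᶜ.indicator (fun x =>
      ((inner ℝ θ ((unitBall ι).indicator (fun y => y) (proj J x)) : ℝ) : ℂ)) x := by
    intro x
    unfold levyIntegrand
    rw [inner_proj_left]
    by_cases hx : x ∈ unitBall ι
    · have hpx : proj J x ∈ unitBall ι := (norm_proj_le J x).trans hx
      simp [hx, hpx, inner_proj_left]
    · by_cases hpx : proj J x ∈ unitBall ι <;> simp [hx, hpx]
  rw [levyExponent_eq, integral_projMeasure, inner_add_left, Complex.ofReal_add, hdi,
    integral_congr_ae (ae_of_all _ key), integral_add hint (hint2.const_mul _),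
    integral_const_mul, real_inner_comm, inner_proj_left, real_inner_comm]
  have hS : ∀ k l, proj J θ k * S k l * proj J θ l
      = θ k * (if k ∈ J ∧ l ∈ J then S k l else 0) * θ l := by
    intro k l
    by_cases hk : k ∈ J <;> by_cases hl : l ∈ J <;> simp [hk, hl]
  simp_rw [hS]
  ring

end Proj

section Diamond

variable {n : ℕ}

lemma compensation_eq (t : E (Fin n)) (ν : Measure (E (Fin n))) :
    compensation t ν = ∑ k, spacing t k • projDrift (upper t k) ν := by
  unfold compensation
  rw [Finset.sum_filter]
  refine Finset.sum_congr rfl fun k _ => ?_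
  split_ifs with h
  · rfl
  · have h0 : projDrift (upper t k) ν = 0 := by
      rw [upper_of_val_eq_zero t (by omega), projDrift]
      refine (setIntegral_congr_fun measurableSet_unitBall.compl fun x hx => ?_).trans
        (integral_zero _ _)
      rw [proj_univ]
      exact Set.indicator_of_notMem hx _
    rw [h0, smul_zero]

lemma sum_smul_proj_upper (t μ : E (Fin n)) :
    ∑ j, spacing t j • proj (upper t j) μ = diamondVec t μ := by
  ext k
  have h := sum_spacing_upper t k
  simp only [WithLp.ofLp_sum, Finset.sum_apply, WithLp.ofLp_smul, Pi.smul_apply, smul_eq_mul,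
    proj_apply, diamondVec]
  rw [← h, Finset.sum_mul]
  refine Finset.sum_congr rfl fun j _ => ?_
  split_ifs <;> simp

lemma isLevyMeasure_diamondMeasure (t : E (Fin n)) {ν : Measure (E (Fin n))}
    (hν : IsLevyMeasure ν) : IsLevyMeasure (diamondMeasure t ν) := by
  refine IsLevyMeasure.of_integrable ?_ ?_
  · simp [diamondMeasure, (isLevyMeasure_projMeasure _ hν).zero]
  · exact integrable_finsetSum_measure.2 fun k _ =>
      (isLevyMeasure_projMeasure _ hν).integrable_min.smul_measure ENNReal.ofReal_ne_top

/-- The exponent of the triplet `(c(t,ν) + t⋄μ, t⋄S, t⋄ν)` is `∑_k Δt_(k) Ψ(π_{J_k} θ)`. -/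
lemma levyExponent_diamond {t : E (Fin n)} (ht : ∀ k, 0 ≤ t k) (μ : E (Fin n))
    (S : Matrix (Fin n) (Fin n) ℝ) {ν : Measure (E (Fin n))} (hν : IsLevyMeasure ν)
    (θ : E (Fin n)) :
    levyExponent (compensation t ν + diamondVec t μ) (diamondMat t S) (diamondMeasure t ν) θ
      = ∑ j, (spacing t j : ℂ) * levyExponent μ S ν (proj (upper t j) θ) := by
  have hi : ∫ x, levyIntegrand θ x ∂(diamondMeasure t ν)
      = ∑ j, (spacing t j : ℂ) * ∫ x, levyIntegrand θ x ∂(projMeasure (upper t j) ν) := by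
    unfold diamondMeasure
    rw [integral_finsetSum_measure fun k _ =>
      ((isLevyMeasure_projMeasure _ hν).integrable_levyIntegrand θ).smul_measure
        ENNReal.ofReal_ne_top]
    refine Finset.sum_congr rfl fun k _ => ?_
    rw [integral_smul_measure, ENNReal.toReal_ofReal (spacing_nonneg ht k), Complex.real_smul]
  have hv : compensation t ν + diamondVec t μ
      = ∑ j, spacing t j • (proj (upper t j) μ + projDrift (upper t j) ν) := by
    simp_rw [smul_add]
    rw [Finset.sum_add_distrib, sum_smul_proj_upper, compensation_eq, add_comm]
  obtain ⟨Q, hQ⟩ : ∃ Q : Fin n → ℝ, ∀ j, Q j = ∑ k, ∑ l,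
      θ k * (if k ∈ upper t j ∧ l ∈ upper t j then S k l else 0) * θ l := ⟨_, fun _ => rfl⟩
  have hm : ∑ k, ∑ l, θ k * diamondMat t S k l * θ l = ∑ j, spacing t j * Q j := by
    simp_rw [hQ, Finset.mul_sum]
    refine Eq.trans (Finset.sum_congr rfl fun k _ => ?_) Finset.sum_comm
    refine Eq.trans (Finset.sum_congr rfl fun l _ => ?_) Finset.sum_comm
    rw [diamondMat, Matrix.of_apply, ← sum_spacing_upper_inter, Finset.mul_sum, Finset.mul_sum,
      Finset.sum_mul]
    refine Finset.sum_congr rfl fun j _ => ?_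
    split_ifs <;> ring
  simp_rw [levyExponent_proj μ S hν, ← hQ]
  rw [levyExponent_eq, hi, hv, hm, sum_inner]
  push_cast
  simp_rw [inner_smul_left, Finset.mul_sum]
  simp only [mul_add, mul_sub, Finset.sum_add_distrib, Finset.sum_sub_distrib]
  congr 2
  · simp only [conj_trivial, Complex.ofReal_mul]
    exact Finset.sum_congr rfl fun j _ => by ring
  · refine Finset.sum_congr rfl fun j _ => ?_
    ring

end Diamond

/-! ### Lévy processes and the characteristic functions of their increments -/

section Increments

variable {ι Ω : Type*} [Fintype ι] {mΩ : MeasurableSpace Ω} {P : Measure Ω}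

lemma charFun_map_eq {Y : Ω → E ι} (hY : AEMeasurable Y P) (θ : E ι) :
    charFun (P.map Y) θ = ∫ ω, Complex.exp (Complex.I * (inner ℝ θ (Y ω) : ℝ)) ∂P := by
  rw [charFun_apply, integral_map hY (by fun_prop)]
  simp_rw [real_inner_comm θ, mul_comm]

lemma integral_exp_sum_of_iIndepFun {m : ℕ} {Y : Fin m → Ω → E ι} [IsProbabilityMeasure P]
    (hY : ∀ j, AEMeasurable (Y j) P) (h : iIndepFun Y P) (θ : Fin m → E ι) :
    ∫ ω, Complex.exp (Complex.I * ((∑ j, inner ℝ (θ j) (Y j ω) : ℝ) : ℂ)) ∂P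
      = ∏ j, ∫ ω, Complex.exp (Complex.I * (inner ℝ (θ j) (Y j ω) : ℝ)) ∂P := by
  rw [← h.integral_fun_prod_comp hY
    (f := fun j y => Complex.exp (Complex.I * (inner ℝ (θ j) y : ℝ))) (fun j => by fun_prop)]
  refine integral_congr_ae (ae_of_all _ fun ω => ?_)
  simp only
  rw [← Complex.exp_sum, Complex.ofReal_sum, Finset.mul_sum]

lemma iIndepFun_of_integral_exp_sum {m : ℕ} {Y : Fin m → Ω → E ι} [IsProbabilityMeasure P]
    (hY : ∀ j, AEMeasurable (Y j) P)
    (h : ∀ θ : Fin m → E ι,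
      ∫ ω, Complex.exp (Complex.I * ((∑ j, inner ℝ (θ j) (Y j ω) : ℝ) : ℂ)) ∂P
        = ∏ j, ∫ ω, Complex.exp (Complex.I * (inner ℝ (θ j) (Y j ω) : ℝ)) ∂P) :
    iIndepFun Y P := by
  rw [iIndepFun_iff_charFun_pi hY]
  intro t
  rw [Finset.prod_congr rfl fun j _ => charFun_map_eq (hY j) (t j)]
  rw [← h fun j => t j, charFun_apply, integral_map (by fun_prop) (by fun_prop)]
  refine integral_congr_ae (ae_of_all _ fun ω => ?_)
  beta_reduce
  rw [PiLp.inner_apply, mul_comm, Finset.sum_congr rfl fun j _ => real_inner_comm (t j) (Y j ω)]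

/-- Along a chain of times, the characteristic function of the increments of a Lévy process
factorizes. -/
lemma HasTriplet.integral_exp_increments [IsProbabilityMeasure P] {X : ℝ≥0 → Ω → E ι} {μ : E ι}
    {S : Matrix ι ι ℝ} {ν : Measure (E ι)} (hX : HasTriplet X P μ S ν) {m : ℕ}
    {r : Fin (m + 1) → ℝ≥0} (hr : Monotone r) (θ : Fin m → E ι) :
    ∫ ω, Complex.exp (Complex.I *
        ((∑ j, inner ℝ (θ j) (X (r j.succ) ω - X (r j.castSucc) ω) : ℝ) : ℂ)) ∂P
      = ∏ j, Complex.exp (((r j.succ : ℝ) - (r j.castSucc : ℝ) : ℝ)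
          * levyExponent μ S ν (θ j)) := by
  have hY : ∀ j : Fin m, AEMeasurable (fun ω => X (r j.succ) ω - X (r j.castSucc) ω) P :=
    fun j => (hX.levy.aemeasurable _).sub (hX.levy.aemeasurable _)
  rw [integral_exp_sum_of_iIndepFun hY (hX.levy.indep m r hr)]
  refine Finset.prod_congr rfl fun j _ => ?_
  have hle : r j.castSucc ≤ r j.succ := hr (Fin.castSucc_le_succ j)
  have hst := hX.levy.stationary (r j.castSucc) (r j.succ - r j.castSucc)
  rw [add_tsub_cancel_of_le hle] at hst
  rw [← charFun_map_eq (hY j), hst.map_eq, hX.charFun_eq, NNReal.coe_sub hle]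

/-- A càdlàg process started at `0` is a Lévy process as soon as the characteristic functions of
its increments along chains of times factorize through a single exponent. -/
lemma isLevyProcess_of_integral_exp_increments [IsProbabilityMeasure P] {Z : ℝ≥0 → Ω → E ι}
    (hm : ∀ t, AEMeasurable (Z t) P) (h0 : ∀ᵐ ω ∂P, Z 0 ω = 0)
    (hc : ∀ᵐ ω ∂P, IsCadlagPath fun t => Z t ω) (K : E ι → ℂ)
    (h : ∀ (m : ℕ) (r : Fin (m + 1) → ℝ≥0), Monotone r → ∀ θ : Fin m → E ι,
      ∫ ω, Complex.exp (Complex.I *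
        ((∑ j, inner ℝ (θ j) (Z (r j.succ) ω - Z (r j.castSucc) ω) : ℝ) : ℂ)) ∂P
      = ∏ j, Complex.exp (((r j.succ : ℝ) - (r j.castSucc : ℝ) : ℝ) * K (θ j))) :
    IsLevyProcess Z P ∧ ∀ t θ, charFun (P.map (Z t)) θ = Complex.exp ((t : ℝ) * K θ) := by
  have hsub : ∀ s t, AEMeasurable (fun ω => Z t ω - Z s ω) P := fun s t => (hm t).sub (hm s)
  have hone : ∀ (s t : ℝ≥0), s ≤ t → ∀ θ,
      ∫ ω, Complex.exp (Complex.I * (inner ℝ θ (Z t ω - Z s ω) : ℝ)) ∂P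
        = Complex.exp (((t : ℝ) - (s : ℝ) : ℝ) * K θ) := by
    intro s t hst θ
    have hmono : Monotone ![s, t] := by
      rw [Fin.monotone_iff_le_succ]
      intro i
      fin_cases i
      exact hst
    simpa using h 1 ![s, t] hmono fun _ => θ
  have hchar : ∀ t θ, charFun (P.map (Z t)) θ = Complex.exp ((t : ℝ) * K θ) := by
    intro t θ
    have := hone 0 t zero_le θ
    rw [NNReal.coe_zero, sub_zero] at this
    rw [charFun_map_eq (hm t), ← this]
    refine integral_congr_ae ?_
    filter_upwards [h0] with ω hω
    rw [hω, sub_zero]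
  refine ⟨⟨hm, h0, fun m r hr => ?_, fun s t => ⟨hsub _ _, hm t, ?_⟩, hc⟩, hchar⟩
  · refine iIndepFun_of_integral_exp_sum (fun j => hsub _ _) fun θ => ?_
    rw [h m r hr θ]
    exact Finset.prod_congr rfl fun j _ => (hone _ _ (hr (Fin.castSucc_le_succ j)) _).symm
  · have := Measure.isProbabilityMeasure_map (hm t)
    have := Measure.isProbabilityMeasure_map (hsub s (s + t))
    refine Measure.ext_of_charFun (funext fun θ => ?_)
    rw [charFun_map_eq (hsub _ _), hone _ _ le_self_add, hchar]
    simp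

/-- Having a given triplet only depends on the process up to indistinguishability. -/
lemma HasTriplet.congr {X Y : ℝ≥0 → Ω → E ι} {μ : E ι} {S : Matrix ι ι ℝ} {ν : Measure (E ι)}
    (hX : HasTriplet X P μ S ν) (h : ∀ᵐ ω ∂P, ∀ t, Y t ω = X t ω) : HasTriplet Y P μ S ν := by
  have ht : ∀ t, X t =ᵐ[P] Y t := fun t => h.mono fun ω hω => (hω t).symm
  refine ⟨⟨fun t => (hX.levy.aemeasurable t).congr (ht t), ?_, fun m r hr => ?_, fun s t => ?_, ?_⟩,
    hX.cov, hX.levyMeasure, fun t θ => ?_⟩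
  · filter_upwards [h, hX.levy.zero] with ω h1 h2
    rw [h1, h2]
  · exact (hX.levy.indep m r hr).congr fun j => (ht _).sub (ht _)
  · have hst := hX.levy.stationary s t
    refine ⟨hst.aemeasurable_fst.congr ((ht _).sub (ht _)),
      hst.aemeasurable_snd.congr (ht t), ?_⟩
    rw [← Measure.map_congr (ht t), ← hst.map_eq]
    exact (Measure.map_congr ((ht _).sub (ht _))).symm
  · filter_upwards [h, hX.levy.cadlag] with ω h1 h2
    simpa only [h1] using h2
  · rw [← Measure.map_congr (ht t), hX.charFun_eq]

lemma HasTriplet.levyExponent_re_nonpos [IsProbabilityMeasure P] {X : ℝ≥0 → Ω → E ι} {μ : E ι}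
    {S : Matrix ι ι ℝ} {ν : Measure (E ι)} (hX : HasTriplet X P μ S ν) (θ : E ι) :
    (levyExponent μ S ν θ).re ≤ 0 := by
  have := Measure.isProbabilityMeasure_map (hX.levy.aemeasurable 1)
  have h := norm_charFun_le_one (μ := P.map (X 1)) (t := θ)
  rw [hX.charFun_eq, Complex.norm_exp] at h
  simpa using h

end Increments

/-! ### The Laplace exponent of a subordinator -/

section Laplace

lemma norm_exp_sub_one_le_of_re_nonpos {w : ℂ} (hw : w.re ≤ 0) :
    ‖Complex.exp w - 1‖ ≤ 2 * min ‖w‖ 1 := by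
  rcases le_total ‖w‖ 1 with h | h
  · rw [min_eq_left h]
    exact Complex.norm_exp_sub_one_le h
  · rw [min_eq_right h]
    have h1 := norm_sub_le (Complex.exp w) 1
    have h2 : ‖Complex.exp w‖ ≤ 1 := by rw [Complex.norm_exp]; exact Real.exp_le_one_iff.2 hw
    rw [norm_one] at h1
    linarith

variable {α : Type*} {mα : MeasurableSpace α}

lemma re_I_mul_sub_mul (z : ℂ) (a b : ℝ) : (Complex.I * b - z * a).re = -(z.re * a) := by
  simp

lemma norm_exp_I_mul_sub_one_le {z : ℂ} (hz : 0 ≤ z.re) {a : ℝ} (ha : 0 ≤ a) (b : ℝ) :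
    ‖Complex.exp (Complex.I * b - z * a) - 1‖ ≤ 2 * (1 + ‖z‖) * min (|b| + a) 1 := by
  have hre : (Complex.I * b - z * a).re ≤ 0 := by
    rw [re_I_mul_sub_mul]
    exact neg_nonpos.2 (mul_nonneg hz ha)
  refine (norm_exp_sub_one_le_of_re_nonpos hre).trans ?_
  have h1 : ‖Complex.I * b - z * a‖ ≤ (1 + ‖z‖) * (|b| + a) := by
    refine (norm_sub_le _ _).trans ?_
    rw [norm_mul, norm_mul, Complex.norm_I, Complex.norm_real, Complex.norm_real,
      Real.norm_eq_abs, Real.norm_eq_abs, abs_of_nonneg ha]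
    nlinarith [norm_nonneg z, abs_nonneg b, mul_nonneg (norm_nonneg z) (abs_nonneg b)]
  have h2 : min ‖Complex.I * b - z * a‖ 1 ≤ (1 + ‖z‖) * min (|b| + a) 1 := by
    rw [mul_min_of_nonneg _ _ (by positivity)]
    refine min_le_min h1 ?_
    linarith [norm_nonneg z]
  linarith

/-- The compensated Laplace transform `z ↦ ∫ (e^{ib - za} - 1) dm` for `a ≥ 0`. -/
def expTransform (m : Measure α) (b a : α → ℝ) (z : ℂ) : ℂ :=
  ∫ s, (Complex.exp (Complex.I * b s - z * a s) - 1) ∂m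

variable {m : Measure α} {a b : α → ℝ}

lemma integrable_expTransform (ha : Measurable a) (hb : Measurable b) (ha0 : ∀ᵐ s ∂m, 0 ≤ a s)
    (hint : Integrable (fun s => min (|b s| + a s) 1) m) {z : ℂ} (hz : 0 ≤ z.re) :
    Integrable (fun s => Complex.exp (Complex.I * b s - z * a s) - 1) m :=
  (hint.const_mul (2 * (1 + ‖z‖))).mono' (by fun_prop)
    (ha0.mono fun s hs => norm_exp_I_mul_sub_one_le hz hs (b s))

lemma continuousOn_expTransform (ha : Measurable a) (hb : Measurable b)
    (ha0 : ∀ᵐ s ∂m, 0 ≤ a s) (hint : Integrable (fun s => min (|b s| + a s) 1) m) :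
    ContinuousOn (expTransform m b a) {z | 0 ≤ z.re} := by
  intro z₀ _
  refine continuousWithinAt_of_dominated
    (bound := fun s => 2 * (1 + (‖z₀‖ + 1)) * min (|b s| + a s) 1)
    (Eventually.of_forall fun z => by fun_prop) ?_ (hint.const_mul _)
    (ae_of_all _ fun s => by fun_prop)
  have hball : ∀ᶠ z in 𝓝[{z : ℂ | 0 ≤ z.re}] z₀, ‖z‖ ≤ ‖z₀‖ + 1 := by
    refine nhdsWithin_le_nhds ?_
    exact (continuous_norm.tendsto z₀).eventually_le_const (by linarith)
  filter_upwards [hball, self_mem_nhdsWithin] with z hz hz0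
  filter_upwards [ha0] with s hs
  have : 0 ≤ min (|b s| + a s) 1 := by positivity
  exact (norm_exp_I_mul_sub_one_le hz0 hs (b s)).trans (by gcongr)

lemma differentiableOn_expTransform (ha : Measurable a) (hb : Measurable b)
    (ha0 : ∀ᵐ s ∂m, 0 ≤ a s) (hint : Integrable (fun s => min (|b s| + a s) 1) m) :
    DifferentiableOn ℂ (expTransform m b a) {z | 0 < z.re} := by
  intro z₀ hz₀
  have hz₀' : 0 < z₀.re := hz₀
  set ε := z₀.re / 2 with hε
  have hε0 : 0 < ε := by positivity
  have hre : ∀ z ∈ Metric.ball z₀ ε, ε ≤ z.re := by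
    intro z hz
    have h1 := (Complex.abs_re_le_norm (z - z₀)).trans (mem_ball_iff_norm.1 hz).le
    rw [Complex.sub_re] at h1
    linarith [(abs_le.1 h1).1]
  refine DifferentiableAt.differentiableWithinAt (HasDerivAt.differentiableAt
    (hasDerivAt_integral_of_dominated_loc_of_deriv_le
    (F' := fun z s => Complex.exp (Complex.I * b s - z * a s) * (-(a s : ℂ)))
    (bound := fun s => (1 + 1 / ε) * min (|b s| + a s) 1) (Metric.ball_mem_nhds z₀ hε0)
    (Eventually.of_forall fun z => by fun_prop)
    (integrable_expTransform ha hb ha0 hint hz₀'.le) (by fun_prop) ?_ (hint.const_mul _) ?_).2)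
  · filter_upwards [ha0] with s hs z hz
    have h1 := hre z hz
    rw [norm_mul, Complex.norm_exp, re_I_mul_sub_mul, norm_neg, Complex.norm_real,
      Real.norm_of_nonneg hs]
    have h2 : Real.exp (-(z.re * a s)) ≤ 1 := Real.exp_le_one_iff.2 (by
      have := hε0.le.trans h1; exact neg_nonpos.2 (mul_nonneg this hs))
    have h3 : Real.exp (-(z.re * a s)) * a s ≤ 1 / ε := by
      have h4 : ε * a s ≤ Real.exp (z.re * a s) := by
        have := Real.add_one_le_exp (z.re * a s)
        nlinarith
      rw [Real.exp_neg, le_div_iff₀ hε0, mul_assoc, inv_mul_le_iff₀ (Real.exp_pos _)]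
      linarith
    have h5 : 0 < 1 / ε := by positivity
    rw [mul_min_of_nonneg _ _ (by positivity)]
    refine le_min ?_ (by linarith)
    nlinarith [abs_nonneg (b s), mul_nonneg h5.le (add_nonneg (abs_nonneg (b s)) hs)]
  · refine ae_of_all _ fun s z _ => ?_
    have h1 : HasDerivAt (fun z : ℂ => Complex.I * b s - z * a s) (-(a s : ℂ)) z := by
      simpa using ((hasDerivAt_id z).mul_const (a s : ℂ)).const_sub (Complex.I * b s)
    exact (h1.cexp.sub_const 1)

lemma diffContOnCl_expTransform (ha : Measurable a) (hb : Measurable b)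
    (ha0 : ∀ᵐ s ∂m, 0 ≤ a s) (hint : Integrable (fun s => min (|b s| + a s) 1) m) :
    DiffContOnCl ℂ (expTransform m b a) {z | 0 < z.re} :=
  ⟨differentiableOn_expTransform ha hb ha0 hint, by
    rw [Complex.closure_setOfPred_lt_re]; exact continuousOn_expTransform ha hb ha0 hint⟩

lemma re_expTransform_nonpos (ha : Measurable a) (hb : Measurable b)
    (ha0 : ∀ᵐ s ∂m, 0 ≤ a s) (hint : Integrable (fun s => min (|b s| + a s) 1) m) {z : ℂ}
    (hz : 0 ≤ z.re) : (expTransform m b a z).re ≤ 0 := by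
  have h := integrable_expTransform ha hb ha0 hint hz
  rw [expTransform, ← RCLike.re_eq_complex_re, ← integral_re h]
  refine integral_nonpos_of_ae ?_
  filter_upwards [ha0] with s hs
  have h1 := (Complex.re_le_norm (Complex.exp (Complex.I * b s - z * a s)))
  rw [Complex.norm_exp, re_I_mul_sub_mul] at h1
  have h2 : Real.exp (-(z.re * a s)) ≤ 1 :=
    Real.exp_le_one_iff.2 (neg_nonpos.2 (mul_nonneg hz hs))
  simp only [RCLike.re_eq_complex_re, Complex.sub_re, Complex.one_re, Pi.zero_apply]
  linarith

/-- Two functions that are holomorphic and bounded on the right half-plane, continuous up to the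
boundary, and equal on the imaginary axis are equal. -/
lemma eq_of_bounded_of_eq_on_imaginary_axis {f g : ℂ → ℂ}
    (hf : DiffContOnCl ℂ f {z | 0 < z.re}) (hg : DiffContOnCl ℂ g {z | 0 < z.re}) {C : ℝ}
    (hfC : ∀ z : ℂ, 0 ≤ z.re → ‖f z‖ ≤ C) (hgC : ∀ z : ℂ, 0 ≤ z.re → ‖g z‖ ≤ C)
    (h : ∀ x : ℝ, f (x * Complex.I) = g (x * Complex.I)) {z : ℂ} (hz : 0 ≤ z.re) :
    f z = g z := by
  have hb : ∀ z : ℂ, 0 ≤ z.re → ‖(f - g) z‖ ≤ C + C := fun z hz =>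
    (norm_sub_le _ _).trans (add_le_add (hfC z hz) (hgC z hz))
  have := PhragmenLindelof.right_half_plane_of_bounded_on_real (f := f - g) (C := 0) (z := z)
    (hf.sub hg) ⟨1, by norm_num, 0, ?_⟩ ?_ (fun x => by simp [h x]) hz
  · exact sub_eq_zero.1 (norm_le_zero_iff.1 this)
  · refine Asymptotics.IsBigO.of_bound (C + C) ?_
    refine mem_inf_of_right ?_
    intro z hz
    have := hb z (le_of_lt hz)
    simpa using this
  · refine isBoundedUnder_of_eventually_le (a := C + C) ?_
    filter_upwards [eventually_ge_atTop 0] with x hx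
    exact hb x (by simpa using hx)

variable {ι Ω : Type*} [Fintype ι] {mΩ : MeasurableSpace Ω} {P : Measure Ω}

lemma IsSubordinator.integrable_min_norm {T : ℝ≥0 → Ω → E ι} {d : E ι} {τ : Measure (E ι)}
    (hT : IsSubordinator T P d τ) : Integrable (fun s => min ‖s‖ 1) τ := by
  have h1 : IntegrableOn (fun s : E ι => ‖s‖) (unitBall ι) τ := by
    refine ⟨by fun_prop, ?_⟩
    rw [hasFiniteIntegral_iff_ofReal (ae_of_all _ fun x => by positivity)]
    exact hT.finiteVariation
  rw [← integrableOn_univ, ← Set.union_compl_self (unitBall ι)]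
  refine IntegrableOn.union ?_ ?_
  · refine h1.mono' (by fun_prop) (ae_of_all _ fun s => ?_)
    rw [Real.norm_of_nonneg (by positivity)]
    exact min_le_left _ _
  · refine (hT.triplet.levyMeasure.integrable_min.restrict (s := (unitBall ι)ᶜ)).mono'
      (by fun_prop) ?_
    refine (ae_restrict_iff' measurableSet_unitBall.compl).2 (ae_of_all _ fun x hx => ?_)
    have hx1 : 1 < ‖x‖ := not_le.1 hx
    rw [min_eq_right hx1.le, norm_one, min_eq_right (by nlinarith)]

lemma IsSubordinator.ae_nonneg_levyMeasure {T : ℝ≥0 → Ω → E ι} {d : E ι} {τ : Measure (E ι)}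
    (hT : IsSubordinator T P d τ) : ∀ᵐ s ∂τ, ∀ k, 0 ≤ s k := by
  rw [ae_iff]
  exact hT.orthant

lemma IsSubordinator.ae_nonneg {T : ℝ≥0 → Ω → E ι} {d : E ι} {τ : Measure (E ι)}
    (hT : IsSubordinator T P d τ) (t : ℝ≥0) : ∀ᵐ ω ∂P, ∀ k, 0 ≤ T t ω k := by
  filter_upwards [hT.nondecreasing, hT.triplet.levy.zero] with ω h1 h2 k
  have := h1 k (zero_le : (0 : ℝ≥0) ≤ t)
  simpa [h2] using this

/-- As a subordinator has finite variation, its exponent needs no compensation. -/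
lemma IsSubordinator.levyExponent_eq {T : ℝ≥0 → Ω → E ι} {d : E ι} {τ : Measure (E ι)}
    (hT : IsSubordinator T P d τ) (θ : E ι) :
    levyExponent (d + ∫ x in unitBall ι, x ∂τ) 0 τ θ
      = Complex.I * (inner ℝ θ d : ℝ)
        + ∫ s, (Complex.exp (Complex.I * (inner ℝ θ s : ℝ)) - 1) ∂τ := by
  have h1 : IntegrableOn (fun s : E ι => s) (unitBall ι) τ := by
    refine ⟨by fun_prop, ?_⟩
    rw [hasFiniteIntegral_iff_norm]
    exact hT.finiteVariation
  have h2 : Integrable (fun x => Complex.I *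
      (((unitBall ι).indicator (fun y => inner ℝ θ y) x : ℝ) : ℂ)) τ := by
    have : Integrable ((unitBall ι).indicator (fun y => (inner ℝ θ y : ℝ))) τ :=
      (integrable_indicator_iff measurableSet_unitBall).2 (h1.const_inner θ)
    exact this.ofReal.const_mul _
  have h3 : ∫ x, Complex.I * (((unitBall ι).indicator (fun y => inner ℝ θ y) x : ℝ) : ℂ) ∂τ
      = Complex.I * ((inner ℝ (∫ x in unitBall ι, x ∂τ) θ : ℝ) : ℂ) := by
    rw [integral_const_mul, integral_complex_ofReal, integral_indicator measurableSet_unitBall,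
      integral_inner h1, real_inner_comm]
  have h4 := hT.triplet.levyMeasure.integrable_levyIntegrand θ
  have h5 : ∀ s, Complex.exp (Complex.I * (inner ℝ θ s : ℝ)) - 1 = levyIntegrand θ s
      + Complex.I * (((unitBall ι).indicator (fun y => inner ℝ θ y) s : ℝ) : ℂ) := by
    intro s; unfold levyIntegrand; ring
  rw [WeakSubordination.levyExponent_eq]
  simp_rw [h5]
  rw [integral_add h4 h2, h3, inner_add_left, real_inner_comm θ d]
  simp
  ring

/-- The Laplace exponent formula for a subordinator. It extends the Lévy–Khintchine formula from
imaginary arguments to arguments with nonpositive real part, by uniqueness on the half-plane. -/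
lemma IsSubordinator.integral_exp [IsProbabilityMeasure P] {T : ℝ≥0 → Ω → E ι} {d : E ι}
    {τ : Measure (E ι)} (hT : IsSubordinator T P d τ) {w : ι → ℂ} (hw : ∀ k, (w k).re ≤ 0)
    (t : ℝ≥0) :
    ∫ ω, Complex.exp (∑ k, w k * T t ω k) ∂P = Complex.exp ((t : ℝ) *
      (∑ k, w k * d k + ∫ s, (Complex.exp (∑ k, w k * s k) - 1) ∂τ)) := by
  set a : E ι → ℝ := fun s => ∑ k, -(w k).re * s k with ha
  set b : E ι → ℝ := fun s => ∑ k, (w k).im * s k with hb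
  have ham : Measurable a := by fun_prop
  have hbm : Measurable b := by fun_prop
  have ha0 : ∀ s : E ι, (∀ k, 0 ≤ s k) → 0 ≤ a s := fun s hs =>
    Finset.sum_nonneg fun k _ => mul_nonneg (neg_nonneg.2 (hw k)) (hs k)
  have hsum : ∀ s : E ι, ∑ k, w k * s k = Complex.I * b s - 1 * a s := by
    intro s
    simp only [ha, hb, Complex.ofReal_sum, Finset.mul_sum, ← Finset.sum_sub_distrib]
    refine Finset.sum_congr rfl fun k _ => ?_
    conv_lhs => rw [← Complex.re_add_im (w k)]
    push_cast
    ring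
  -- `e^{ib - za}` is `e^{⟨w, ·⟩}` at `z = 1` and a character `e^{i⟨θ(y), ·⟩}` at `z = iy`
  set θ : ℝ → E ι := fun y => WithLp.toLp 2 fun k => (w k).im + y * (w k).re with hθ
  have hinner : ∀ (y : ℝ) (s : E ι),
      Complex.I * b s - y * Complex.I * a s = Complex.I * (inner ℝ (θ y) s : ℝ) := by
    intro y s
    simp only [ha, hb, hθ, PiLp.inner_apply, RCLike.inner_apply, conj_trivial]
    push_cast
    rw [mul_assoc, mul_left_comm, ← mul_sub, Finset.mul_sum, ← Finset.sum_sub_distrib]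
    congr 1
    refine Finset.sum_congr rfl fun k _ => ?_
    ring
  have hτ0 : ∀ᵐ s ∂τ, 0 ≤ a s := hT.ae_nonneg_levyMeasure.mono ha0
  have hP0 : ∀ᵐ ω ∂P, 0 ≤ a (T t ω) := (hT.ae_nonneg t).mono fun ω hω => ha0 _ hω
  have hτi : Integrable (fun s => min (|b s| + a s) 1) τ := by
    set C := ∑ k, (|(w k).im| + |(w k).re|) with hC
    have hle : ∀ s, |b s| + a s ≤ C * ‖s‖ := by
      intro s
      rw [hC, Finset.sum_mul]
      refine (add_le_add (Finset.abs_sum_le_sum_abs _ _) le_rfl).trans ?_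
      rw [ha, ← Finset.sum_add_distrib]
      refine Finset.sum_le_sum fun k _ => ?_
      have h1 := abs_apply_le_norm s k
      have h2 := le_abs_self (-(w k).re * s k)
      rw [abs_mul, abs_neg] at h2
      rw [abs_mul, add_mul]
      exact add_le_add (by gcongr) (h2.trans (by gcongr))
    have hC0 : 0 ≤ C := by positivity
    refine (hT.integrable_min_norm.const_mul (1 + C)).mono' (by fun_prop) ?_
    filter_upwards [hτ0] with s hs
    rw [Real.norm_of_nonneg (by positivity), mul_min_of_nonneg _ _ (by positivity)]
    refine min_le_min ((hle s).trans ?_) (by linarith)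
    nlinarith [norm_nonneg s]
  obtain ⟨T', hT'm, hT'e⟩ := hT.triplet.levy.aemeasurable t
  have hP0' : ∀ᵐ ω ∂P, 0 ≤ a (T' ω) := by
    filter_upwards [hP0, hT'e] with ω h1 h2
    rwa [← h2]
  have hPi : Integrable (fun ω => min (|b (T' ω)| + a (T' ω)) 1) P := by
    refine Integrable.of_bound (C := 1) (by fun_prop) ?_
    filter_upwards [hP0'] with ω hω
    rw [Real.norm_of_nonneg (by positivity)]
    exact min_le_right _ _
  have hFP : ∀ z : ℂ, 0 ≤ z.re → 1 + expTransform P (fun ω => b (T' ω)) (fun ω => a (T' ω)) z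
      = ∫ ω, Complex.exp (Complex.I * b (T' ω) - z * a (T' ω)) ∂P := by
    intro z hz
    have hi : Integrable (fun ω => Complex.exp (Complex.I * b (T' ω) - z * a (T' ω)) - 1) P :=
      integrable_expTransform (ham.comp hT'm) (hbm.comp hT'm) hP0' hPi hz
    have h1 : ∫ _, (1 : ℂ) ∂P = 1 := by simp
    rw [← h1, expTransform, ← integral_add (integrable_const 1) hi]
    simp
  have hfd := diffContOnCl_expTransform (ham.comp hT'm) (hbm.comp hT'm) hP0' hPi
  have hgd := diffContOnCl_expTransform ham hbm hτ0 hτi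
  have hexp := eq_of_bounded_of_eq_on_imaginary_axis (C := 1)
    (f := fun z => 1 + expTransform P (fun ω => b (T' ω)) (fun ω => a (T' ω)) z)
    (g := fun z => Complex.exp ((t : ℝ) * (Complex.I * b d - z * a d + expTransform τ b a z)))
    (z := 1) (hfd.const_add 1) ?_ ?_ ?_ ?_ (by simp)
  · have hl : ∫ ω, Complex.exp (∑ k, w k * T t ω k) ∂P
        = ∫ ω, Complex.exp (Complex.I * b (T' ω) - 1 * a (T' ω)) ∂P := by
      refine integral_congr_ae ?_
      filter_upwards [hT'e] with ω hω
      rw [hsum, hω]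
    simp_rw [hsum] at hl ⊢
    rw [hl, ← hFP 1 (by simp), hexp]
    rfl
  · have h1 : DiffContOnCl ℂ (fun z : ℂ => (t : ℝ) *
        (Complex.I * b d - z * a d + expTransform τ b a z)) {z | 0 < z.re} := by
      have h2 : DiffContOnCl ℂ (fun z : ℂ => Complex.I * b d - z * a d) {z | 0 < z.re} :=
        Differentiable.diffContOnCl (by fun_prop)
      exact (h2.add hgd).const_smul ((t : ℝ) : ℂ)
    exact (Complex.differentiable_exp.comp_diffContOnCl h1)
  · intro z hz
    rw [hFP z hz]
    refine (norm_integral_le_of_norm_le_const (C := 1) ?_).trans (by simp)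
    filter_upwards [hP0'] with ω hω
    rw [Complex.norm_exp, re_I_mul_sub_mul]
    exact Real.exp_le_one_iff.2 (neg_nonpos.2 (mul_nonneg hz hω))
  · intro z hz
    rw [Complex.norm_exp, Complex.re_ofReal_mul, Complex.add_re, re_I_mul_sub_mul]
    have h1 := re_expTransform_nonpos ham hbm hτ0 hτi hz
    have h2 := mul_nonneg hz (ha0 d hT.drift_nonneg)
    exact Real.exp_le_one_iff.2 (mul_nonpos_of_nonneg_of_nonpos t.2 (by linarith))
  · intro y
    rw [hFP _ (by simp)]
    simp only [expTransform]
    simp_rw [hinner]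
    rw [← hT.levyExponent_eq, ← hT.triplet.charFun_eq,
      charFun_map_eq (hT.triplet.levy.aemeasurable t)]
    refine integral_congr_ae ?_
    filter_upwards [hT'e] with ω hω
    rw [hω]

end Laplace

/-! ### Measurability along càdlàg paths -/

section Regularity

/-- The `k`-th positive point of the grid with mesh `1 / (n + 1)`. -/
def gridPoint (n k : ℕ) : ℝ≥0 := (k + 1) / (n + 1)

/-- The first point strictly after `t` of the grid with mesh `1 / (n + 1)`. -/
def gridTime (n : ℕ) (t : ℝ≥0) : ℝ≥0 := gridPoint n ⌊(n + 1) * t⌋₊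

lemma le_gridTime (n : ℕ) (t : ℝ≥0) : t ≤ gridTime n t := by
  rw [gridTime, gridPoint, le_div_iff₀ (by positivity), mul_comm]
  exact (Nat.lt_floor_add_one _).le

lemma gridTime_le (n : ℕ) (t : ℝ≥0) : gridTime n t ≤ t + 1 / (n + 1) := by
  have h : (0 : ℝ≥0) < n + 1 := by positivity
  rw [gridTime, gridPoint, div_le_iff₀ h, add_mul t, div_mul_cancel₀ _ h.ne', mul_comm t]
  exact add_le_add (Nat.floor_le zero_le) le_rfl

lemma tendsto_gridTime (t : ℝ≥0) : Tendsto (fun n => gridTime n t) atTop (𝓝[≥] t) := by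
  refine tendsto_nhdsWithin_iff.2 ⟨?_, Eventually.of_forall fun n => le_gridTime n t⟩
  refine tendsto_of_tendsto_of_tendsto_of_le_of_le tendsto_const_nhds ?_
    (fun n => le_gridTime n t) (fun n => gridTime_le n t)
  have : Tendsto (fun n : ℕ => (1 : ℝ≥0) / (n + 1)) atTop (𝓝 0) :=
    tendsto_one_div_add_atTop_nhds_zero_nat
  simpa using this.const_add t

variable {ι Ω : Type*}

lemma IsCadlagPath.tendsto_gridTime {F : Type*} [TopologicalSpace F] {f : ℝ≥0 → F}
    (hf : IsCadlagPath f) (t : ℝ≥0) : Tendsto (fun n => f (gridTime n t)) atTop (𝓝 (f t)) :=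
  (hf t).1.tendsto.comp (WeakSubordination.tendsto_gridTime t)

lemma isCadlagPath_zero : IsCadlagPath (0 : ℝ≥0 → E ι) := fun _ =>
  ⟨continuousWithinAt_const, 0, tendsto_const_nhds⟩

/-- The space of càdlàg paths, with the σ-algebra generated by the evaluations. -/
abbrev CadlagPath (ι : Type*) : Type _ := {f : ℝ≥0 → E ι // IsCadlagPath f}

/-- The canonical process on the space of càdlàg paths. -/
def canonicalProcess (t : ℝ≥0) (f : CadlagPath ι) : E ι := f.1 t

lemma measurable_canonicalProcess (t : ℝ≥0) : Measurable (canonicalProcess (ι := ι) t) :=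
  (measurable_pi_apply t).comp measurable_subtype_coe

variable [Fintype ι]

/-- A process with measurable marginals and almost surely càdlàg paths is indistinguishable from a
measurable process all of whose paths are càdlàg; any further almost sure property of the paths
that the zero path shares can be made to hold everywhere. -/
lemma exists_indistinguishable_cadlag {mΩ : MeasurableSpace Ω} {P : Measure Ω}
    {X : ℝ≥0 → Ω → E ι} (hm : ∀ t, AEMeasurable (X t) P) {C : (ℝ≥0 → E ι) → Prop} (hC0 : C 0)
    (hCc : ∀ f, C f → IsCadlagPath f) (h : ∀ᵐ ω ∂P, C fun t => X t ω) :
    ∃ X' : ℝ≥0 → Ω → E ι, (∀ t, Measurable (X' t)) ∧ (∀ ω, C fun t => X' t ω) ∧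
      ∀ᵐ ω ∂P, ∀ t, X' t ω = X t ω := by
  classical
  have hgood : ∀ᵐ ω ∂P, (C fun t => X t ω) ∧
      ∀ p : ℕ × ℕ, X (gridPoint p.1 p.2) ω = (hm (gridPoint p.1 p.2)).mk _ ω :=
    h.and (ae_all_iff.2 fun p => (hm _).ae_eq_mk)
  obtain ⟨N, hsub, hN, hN0⟩ := exists_measurable_superset_of_null (ae_iff.1 hgood)
  have hgoodN : ∀ ω ∉ N, (C fun t => X t ω) ∧
      ∀ p : ℕ × ℕ, X (gridPoint p.1 p.2) ω = (hm (gridPoint p.1 p.2)).mk _ ω := by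
    intro ω hω
    by_contra hcon
    exact hω (hsub hcon)
  set X' : ℝ≥0 → Ω → E ι := fun t => Nᶜ.indicator (X t) with hX'
  have hC' : ∀ ω, C fun t => X' t ω := by
    intro ω
    by_cases hω : ω ∈ N
    · have : (fun t => X' t ω) = 0 := by funext t; simp [hX', hω]
      rwa [this]
    · have : (fun t => X' t ω) = fun t => X t ω := by funext t; simp [hX', hω]
      rw [this]
      exact (hgoodN ω hω).1
  have hgrid : ∀ n k, Measurable (X' (gridPoint n k)) := by
    intro n k
    have : X' (gridPoint n k) = Nᶜ.indicator ((hm (gridPoint n k)).mk _) :=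
      Set.indicator_congr fun ω hω => (hgoodN ω hω).2 (n, k)
    rw [this]
    exact (hm _).measurable_mk.indicator hN.compl
  refine ⟨X', fun t => ?_, hC', ?_⟩
  · refine measurable_of_tendsto_metrizable (f := fun n => X' (gridTime n t))
      (fun n => hgrid _ _) ?_
    rw [tendsto_pi_nhds]
    exact fun ω => (hCc _ (hC' ω)).tendsto_gridTime t
  · filter_upwards [compl_mem_ae_iff.2 hN0] with ω hω t
    exact Set.indicator_of_mem hω _

/-- A measurable process with càdlàg paths is jointly measurable in time and randomness. -/
lemma measurable_uncurry_of_cadlag {mΩ : MeasurableSpace Ω} {X : ℝ≥0 → Ω → E ι}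
    (hm : ∀ t, Measurable (X t)) (hc : ∀ ω, IsCadlagPath fun t => X t ω) :
    Measurable fun p : ℝ≥0 × Ω => X p.1 p.2 := by
  refine measurable_of_tendsto_metrizable (f := fun n (p : ℝ≥0 × Ω) => X (gridTime n p.1) p.2)
    (fun n => ?_) ?_
  · have h1 : Measurable fun q : ℕ × Ω => X (gridPoint n q.1) q.2 :=
      measurable_from_prod_countable_right fun k => hm (gridPoint n k)
    exact h1.comp (g := fun q : ℕ × Ω => X (gridPoint n q.1) q.2)
      (f := fun p : ℝ≥0 × Ω => (⌊((n : ℝ≥0) + 1) * p.1⌋₊, p.2)) (by fun_prop)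
  · rw [tendsto_pi_nhds]
    exact fun p => (hc p.2).tendsto_gridTime p.1

lemma measurable_multiEval {mΩ : MeasurableSpace Ω} {X : ℝ≥0 → Ω → E ι}
    (hm : ∀ t, Measurable (X t)) (hc : ∀ ω, IsCadlagPath fun t => X t ω) :
    Measurable fun p : E ι × Ω => multiEval X p.1 p.2 := by
  have h := measurable_uncurry_of_cadlag hm hc
  have h1 : Measurable fun (p : E ι × Ω) (k : ι) => X (p.1 k).toNNReal p.2 k := by
    refine measurable_pi_lambda _ fun k => ?_
    have h2 : Measurable fun p : E ι × Ω => X (p.1 k).toNNReal p.2 :=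
      h.comp (g := fun p : ℝ≥0 × Ω => X p.1 p.2)
        (f := fun p : E ι × Ω => ((p.1 k).toNNReal, p.2)) (by fun_prop)
    fun_prop
  exact (WithLp.measurable_toLp 2 _).comp h1

lemma measurable_multiEval_canonicalProcess :
    Measurable fun p : E ι × CadlagPath ι => multiEval canonicalProcess p.1 p.2 :=
  measurable_multiEval measurable_canonicalProcess fun f => f.2

/-- For independent `V` and `W`, integrating `G(V, W)` amounts to integrating over `W` with `V`
frozen, and then over `V`. -/
lemma integral_comp_of_indepFun {mΩ : MeasurableSpace Ω} {P : Measure Ω} [IsProbabilityMeasure P]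
    {β γ : Type*} {mβ : MeasurableSpace β} {mγ : MeasurableSpace γ} {V : Ω → β} {W : Ω → γ}
    (hV : Measurable V) (hW : Measurable W) (h : IndepFun V W P) {G : β × γ → ℂ}
    (hG : Measurable G) {C : ℝ} (hC : ∀ p, ‖G p‖ ≤ C) :
    ∫ ω, G (V ω, W ω) ∂P = ∫ ω, ∫ ω', G (V ω, W ω') ∂P ∂P := by
  have := Measure.isProbabilityMeasure_map (μ := P) hV.aemeasurable
  have := Measure.isProbabilityMeasure_map (μ := P) hW.aemeasurable
  have h1 := (indepFun_iff_map_prod_eq_prod_map_map hV.aemeasurable hW.aemeasurable).1 h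
  have h2 : ∫ ω, G (V ω, W ω) ∂P = ∫ p, G p ∂(P.map fun ω => (V ω, W ω)) :=
    (integral_map (by fun_prop) hG.aestronglyMeasurable).symm
  rw [h2, h1, integral_prod _ (Integrable.of_bound hG.aestronglyMeasurable C (ae_of_all _ hC)),
    integral_map hV.aemeasurable hG.stronglyMeasurable.integral_prod_right'.aestronglyMeasurable]
  refine integral_congr_ae (ae_of_all _ fun ω => ?_)
  exact integral_map hW.aemeasurable
    (hG.comp (measurable_prodMk_left (x := V ω))).aestronglyMeasurable

end Regularity

/-! ### Time changes of càdlàg paths -/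

section TimeChange

variable {ι : Type*}

lemma IsCadlagPath.continuous_comp {F G : Type*} [TopologicalSpace F] [TopologicalSpace G]
    {f : ℝ≥0 → F} (hf : IsCadlagPath f) {φ : F → G} (hφ : Continuous φ) :
    IsCadlagPath fun t => φ (f t) := by
  intro t
  obtain ⟨l, hl⟩ := (hf t).2
  exact ⟨hφ.continuousAt.comp_continuousWithinAt (hf t).1, φ l, (hφ.tendsto l).comp hl⟩

lemma isCadlagPath_of_apply {f : ℝ≥0 → E ι} (h : ∀ k, IsCadlagPath fun t => f t k) :
    IsCadlagPath f := by
  have h1 : IsCadlagPath fun t k => f t k := by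
    intro t
    choose l hl using fun k => (h k t).2
    exact ⟨continuousWithinAt_pi.2 fun k => (h k t).1, l, tendsto_pi_nhds.2 hl⟩
  exact h1.continuous_comp (PiLp.continuous_toLp 2 _)

/-- A nondecreasing càdlàg time change of a càdlàg path is càdlàg: from the left, the time change
is either eventually constant or approaches its limit strictly from below. -/
lemma IsCadlagPath.comp_monotone {F : Type*} [TopologicalSpace F] {f : ℝ≥0 → F}
    (hf : IsCadlagPath f) {g : ℝ≥0 → ℝ≥0} (hg : IsCadlagPath g) (hmono : Monotone g) :
    IsCadlagPath fun t => f (g t) := by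
  intro t
  refine ⟨(hf (g t)).1.comp (hg t).1 fun s hs => hmono hs, ?_⟩
  obtain ⟨l, hl⟩ := (hg t).2
  by_cases hbot : (𝓝[<] t).NeBot
  · have hle : ∀ s < t, g s ≤ l := by
      intro s hs
      refine ge_of_tendsto hl ?_
      filter_upwards [Ioo_mem_nhdsLT hs] with r hr
      exact hmono hr.1.le
    by_cases hex : ∃ s < t, g s = l
    · obtain ⟨s, hs, hsl⟩ := hex
      refine ⟨f l, tendsto_const_nhds.congr' ?_⟩
      filter_upwards [Ioo_mem_nhdsLT hs] with r hr
      rw [le_antisymm (hle r hr.2) (hsl ▸ hmono hr.1.le)]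
    · obtain ⟨l', hl'⟩ := (hf l).2
      refine ⟨l', hl'.comp (tendsto_nhdsWithin_iff.2 ⟨hl, ?_⟩)⟩
      filter_upwards [self_mem_nhdsWithin] with s hs
      exact lt_of_le_of_ne (hle s hs) fun h => hex ⟨s, hs, h⟩
  · rw [not_neBot.1 hbot]
    exact ⟨f l, tendsto_bot⟩

lemma isCadlagPath_pair_multiEval {Ω : Type*} {X T : ℝ≥0 → Ω → E ι} {ω : Ω}
    (hX : IsCadlagPath fun t => X t ω) (hT : IsCadlagPath fun t => T t ω)
    (hmono : ∀ k, Monotone fun t => T t ω k) :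
    IsCadlagPath fun t => pair (T t ω) (subordinate X T t ω) := by
  refine isCadlagPath_of_apply ?_
  rintro (k | k)
  · exact hT.continuous_comp (φ := fun x : E ι => x k) (by fun_prop)
  · have h1 : IsCadlagPath fun t => (T t ω k).toNNReal :=
      hT.continuous_comp (φ := fun x : E ι => (x k).toNNReal) (by fun_prop)
    have h2 := (hX.continuous_comp (φ := fun x : E ι => x k) (by fun_prop)).comp_monotone h1
      (fun s t hst => Real.toNNReal_mono (hmono k hst))
    exact h2

end TimeChange

/-! ### Multivariate times along which the exponent is linear -/

section LinearExponent

variable {ι Ω : Type*}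

lemma multiEval_zero {X : ℝ≥0 → Ω → E ι} {ω : Ω} (h : X 0 ω = 0) : multiEval X 0 ω = 0 := by
  ext k
  simp [multiEval, h]

lemma multiEval_eq_of_forall_eq {X : ℝ≥0 → Ω → E ι} {s : E ι} {r : ℝ≥0} (h : ∀ k, s k = r) (ω : Ω) :
    multiEval X s ω = X r ω := by
  ext k
  simp [multiEval, h]

variable [Fintype ι] {mΩ : MeasurableSpace Ω} {P : Measure Ω}

/-- Along nondecreasing chains of multivariate times in `A`, the increments of `X` are independent
and the exponent of `⟨θ, X(s)⟩` is the linear function `s ↦ ∑ₖ u(θ)ₖ sₖ`. -/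
def HasLinearExponent (X : ℝ≥0 → Ω → E ι) (P : Measure Ω) (A : Set (E ι)) (u : E ι → ι → ℂ) :
    Prop :=
  ∀ (m : ℕ) (s : Fin (m + 1) → E ι), (∀ j, s j ∈ A) → (∀ k, Monotone fun j => s j k) →
    ∀ θ : Fin m → E ι,
      ∫ ω, Complex.exp (Complex.I * ((∑ j, inner ℝ (θ j)
        (multiEval X (s j.succ) ω - multiEval X (s j.castSucc) ω) : ℝ) : ℂ)) ∂P
      = ∏ j, Complex.exp (∑ k, u (θ j) k * ((s j.succ k - s j.castSucc k : ℝ) : ℂ))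

lemma HasLinearExponent.integral_exp_multiEval {X : ℝ≥0 → Ω → E ι} {A : Set (E ι)}
    {u : E ι → ι → ℂ} (h : HasLinearExponent X P A u) (hX0 : ∀ᵐ ω ∂P, X 0 ω = 0) (h0 : 0 ∈ A)
    {s : E ι} (hs : s ∈ A) (hs0 : ∀ k, 0 ≤ s k) (θ : E ι) :
    ∫ ω, Complex.exp (Complex.I * (inner ℝ θ (multiEval X s ω) : ℝ)) ∂P
      = Complex.exp (∑ k, u θ k * s k) := by
  have h1 := h 1 ![0, s] (fun j => by fin_cases j <;> simp [h0, hs]) (fun k => by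
    rw [Fin.monotone_iff_le_succ]
    intro i
    fin_cases i
    simpa using hs0 k) fun _ => θ
  simp only [Finset.univ_unique, Fin.default_eq_zero, Finset.sum_singleton,
    Finset.prod_singleton, Fin.succ_zero_eq_one, Fin.castSucc_zero, Matrix.cons_val_one,
    Matrix.cons_val_zero, Matrix.cons_val_fin_one, PiLp.zero_apply, sub_zero] at h1
  rw [← h1]
  refine integral_congr_ae ?_
  filter_upwards [hX0] with ω hω
  rw [multiEval_zero hω, sub_zero]

/-- The exponent of a one-parameter semigroup is determined by the semigroup, without the ambiguity
of the complex logarithm. -/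
lemma eq_of_forall_exp_mul_eq {a b : ℂ}
    (h : ∀ t : ℝ≥0, Complex.exp ((t : ℝ) * a) = Complex.exp ((t : ℝ) * b)) : a = b := by
  by_contra hab
  have hc : a - b ≠ 0 := sub_ne_zero.2 hab
  have hc0 : 0 < ‖a - b‖ := norm_pos_iff.2 hc
  -- for this `t`, the number `z = t (a - b)` has modulus `1 / 2` and `e^z = 1`, which contradicts
  -- `|e^z - 1 - z| ≤ |z|²`
  set t : ℝ≥0 := (1 / (2 * ‖a - b‖)).toNNReal with ht
  have hn : ‖((t : ℝ) : ℂ) * (a - b)‖ = 1 / 2 := by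
    rw [norm_mul, Complex.norm_real, Real.norm_of_nonneg (NNReal.coe_nonneg t), ht,
      Real.coe_toNNReal _ (by positivity)]
    field_simp
  have h1 : Complex.exp ((t : ℝ) * (a - b)) = 1 := by
    rw [mul_sub, Complex.exp_sub, h, div_self (Complex.exp_ne_zero _)]
  have h2 := Complex.norm_exp_sub_one_sub_id_le (x := ((t : ℝ) : ℂ) * (a - b)) (by
    rw [hn]; norm_num)
  rw [h1, sub_self, zero_sub, norm_neg, hn] at h2
  norm_num at h2

variable {X : ℝ≥0 → Ω → E ι} {μ : E ι} {S : Matrix ι ι ℝ} {ν : Measure (E ι)}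

/-- The times with nonnegative and equal components. -/
def diagonalTimes (ι : Type*) : Set (E ι) := {s | (∀ k, 0 ≤ s k) ∧ ∀ k l, s k = s l}

/-- On the diagonal a Lévy process is observed at a single time; spreading its exponent evenly over
the coordinates makes it a linear function of the multivariate time. -/
lemma HasTriplet.hasLinearExponent_diagonal [IsProbabilityMeasure P] [Nonempty ι]
    (hX : HasTriplet X P μ S ν) :
    HasLinearExponent X P (diagonalTimes ι)
      fun θ _ => levyExponent μ S ν θ / (Fintype.card ι : ℂ) := by
  intro m s hs hmono θ
  obtain ⟨k₀⟩ := ‹Nonempty ι›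
  have hsk : ∀ j k, s j k = (s j k₀).toNNReal := fun j k => by
    rw [Real.coe_toNNReal _ ((hs j).1 k₀)]; exact (hs j).2 k k₀
  simp_rw [fun j ω => multiEval_eq_of_forall_eq (X := X) (hsk j) ω]
  rw [hX.integral_exp_increments (r := fun j => (s j k₀).toNNReal)
    (fun i j hij => Real.toNNReal_mono (hmono k₀ hij))]
  refine Finset.prod_congr rfl fun j _ => ?_
  congr 1
  have hcard : (Fintype.card ι : ℂ) ≠ 0 := by
    have : Nonempty ι := ⟨k₀⟩
    exact_mod_cast Fintype.card_ne_zero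
  rw [Finset.sum_congr rfl fun k _ => by rw [hsk j.succ k, hsk j.castSucc k]]
  rw [Finset.sum_const, Finset.card_univ, nsmul_eq_mul]
  field_simp

/-- With independent components, the exponent splits over the coordinates, each with its own
time. -/
lemma HasTriplet.hasLinearExponent_orthant [IsProbabilityMeasure P] [DecidableEq ι]
    (hX : HasTriplet X P μ S ν) (hind : HasIndependentComponents X P) :
    HasLinearExponent X P {s | ∀ k, 0 ≤ s k}
      fun θ k => levyExponent μ S ν (EuclideanSpace.single k (θ k)) := by
  intro m s hs hmono θ
  set r : ι → Fin (m + 1) → ℝ≥0 := fun k j => (s j k).toNNReal with hr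
  have hrs : ∀ k j, (r k j : ℝ) = s j k := fun k j => Real.coe_toNNReal _ (hs j k)
  set g : ι → (ℝ≥0 → ℝ) → ℝ := fun k f =>
    ∑ j : Fin m, θ j k * (f (r k j.succ) - f (r k j.castSucc)) with hg
  have hgm : ∀ k, Measurable (g k) := fun k => by fun_prop
  have hsum : ∀ ω, ∑ j, inner ℝ (θ j)
      (multiEval X (s j.succ) ω - multiEval X (s j.castSucc) ω)
      = ∑ k, g k (fun t => X t ω k) := by
    intro ω
    simp only [PiLp.inner_apply, hg]
    rw [Finset.sum_comm]
    refine Finset.sum_congr rfl fun k _ => Finset.sum_congr rfl fun j _ => ?_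
    simp [multiEval, hr, mul_comm]
  have hXk : ∀ t k, AEMeasurable (fun ω => X t ω k) P := fun t k => by
    have := hX.levy.aemeasurable t
    fun_prop
  have hgX : ∀ k, AEMeasurable (fun ω => g k (fun t => X t ω k)) P := fun k => by
    simp only [hg]
    exact Finset.aemeasurable_fun_sum _ fun j _ => ((hXk _ k).sub (hXk _ k)).const_mul _
  have hone : ∀ k, ∫ ω, Complex.exp (Complex.I * (g k (fun t => X t ω k) : ℝ)) ∂P
      = ∏ j : Fin m, Complex.exp (((r k j.succ : ℝ) - (r k j.castSucc : ℝ) : ℝ)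
          * levyExponent μ S ν (EuclideanSpace.single k (θ j k))) := by
    intro k
    rw [← hX.integral_exp_increments (r := r k)
      (fun i j hij => Real.toNNReal_mono (hmono k hij))]
    simp [hg, EuclideanSpace.inner_single_left]
  have hcomp : iIndepFun (fun k ω => g k (fun t => X t ω k)) P :=
    iIndepFun.comp hind g hgm
  simp_rw [hsum, Complex.ofReal_sum, Finset.mul_sum, Complex.exp_sum]
  rw [hcomp.integral_fun_prod_comp (f := fun _ y => Complex.exp (Complex.I * (y : ℝ))) hgX
    (fun k => by fun_prop)]
  simp_rw [hone]
  rw [Finset.prod_comm]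
  refine Finset.prod_congr rfl fun j _ => Finset.prod_congr rfl fun k _ => ?_
  rw [hrs, hrs, mul_comm]

/-- With independent components, the Lévy exponent is the sum of the marginal exponents. -/
lemma HasTriplet.levyExponent_eq_sum [IsProbabilityMeasure P] [DecidableEq ι]
    (hX : HasTriplet X P μ S ν) (hind : HasIndependentComponents X P) (θ : E ι) :
    levyExponent μ S ν θ = ∑ k, levyExponent μ S ν (EuclideanSpace.single k (θ k)) := by
  refine eq_of_forall_exp_mul_eq fun t => ?_
  have h1 := (hX.hasLinearExponent_orthant hind).integral_exp_multiEval hX.levy.zero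
    (by simp) (s := WithLp.toLp 2 fun _ => (t : ℝ)) (fun k => t.2) (fun k => t.2) θ
  simp_rw [fun ω => multiEval_eq_of_forall_eq (X := X)
    (s := WithLp.toLp 2 fun _ => (t : ℝ)) (r := t) (fun k => rfl) ω] at h1
  rw [← hX.charFun_eq, charFun_map_eq (hX.levy.aemeasurable t), h1, Finset.mul_sum]
  simp_rw [mul_comm]

lemma levyExponent_zero : levyExponent μ S ν 0 = 0 := by
  rw [levyExponent_eq]
  simp [levyIntegrand]

end LinearExponent

section LinearDrift

variable {n : ℕ}

lemma levyExponent_orthant_drift {Ω : Type*} {mΩ : MeasurableSpace Ω} {P : Measure Ω}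
    [IsProbabilityMeasure P] {X : ℝ≥0 → Ω → E (Fin n)} {μ : E (Fin n)}
    {S : Matrix (Fin n) (Fin n) ℝ} {ν : Measure (E (Fin n))} (hX : HasTriplet X P μ S ν)
    (hind : HasIndependentComponents X P) (d θ : E (Fin n)) :
    ∑ k, levyExponent μ S ν (EuclideanSpace.single k (θ k)) * d k
      = ∑ j, (spacing d j : ℂ) * levyExponent μ S ν (proj (upper d j) θ) := by
  have h : ∀ j, levyExponent μ S ν (proj (upper d j) θ) = ∑ k, if k ∈ upper d j then
      levyExponent μ S ν (EuclideanSpace.single k (θ k)) else 0 := by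
    intro j
    rw [hX.levyExponent_eq_sum hind]
    refine Finset.sum_congr rfl fun k _ => ?_
    rw [proj_apply]
    split_ifs
    · rfl
    · rw [← levyExponent_zero (μ := μ) (S := S) (ν := ν)]
      congr 1
      ext i
      simp
  simp_rw [h, Finset.mul_sum]
  rw [Finset.sum_comm]
  refine Finset.sum_congr rfl fun k _ => ?_
  rw [← sum_spacing_upper d k, Complex.ofReal_sum, Finset.mul_sum]
  refine Finset.sum_congr rfl fun j _ => ?_
  split_ifs <;> simp [mul_comm]

lemma levyExponent_diagonal_drift [NeZero n] {μ : E (Fin n)} {S : Matrix (Fin n) (Fin n) ℝ}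
    {ν : Measure (E (Fin n))} {d : E (Fin n)} (hd : d ∈ diagonalTimes (Fin n)) (θ : E (Fin n)) :
    ∑ k, levyExponent μ S ν θ / (Fintype.card (Fin n) : ℂ) * d k
      = ∑ j, (spacing d j : ℂ) * levyExponent μ S ν (proj (upper d j) θ) := by
  have hs : ∀ j : Fin n, j ≠ 0 → spacing d j = 0 := by
    intro j hj
    have : (j : ℕ) ≠ 0 := fun h => hj (Fin.ext h)
    rw [spacing, if_neg this, sub_eq_zero]
    exact hd.2 _ _
  symm
  rw [Finset.sum_eq_single_of_mem (0 : Fin n) (Finset.mem_univ _)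
    (fun j _ hj => by rw [hs j hj]; simp), upper_of_val_eq_zero d (by simp), proj_univ]
  have h0 : spacing d 0 = d 0 := by
    rw [spacing, if_pos (by simp), sub_zero]
    exact hd.2 _ _
  have hn : (n : ℂ) ≠ 0 := by exact_mod_cast NeZero.ne n
  rw [h0, Finset.sum_congr rfl fun k _ => by rw [hd.2 k 0]]
  rw [Finset.sum_const, Finset.card_univ, nsmul_eq_mul, Fintype.card_fin]
  field_simp

end LinearDrift

/-! ### Subordinators with indistinguishable components -/

section Diagonal

variable {ι Ω : Type*} [Fintype ι] {mΩ : MeasurableSpace Ω} {P : Measure Ω}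
  [IsProbabilityMeasure P] {T : ℝ≥0 → Ω → E ι} {d : E ι} {τ : Measure (E ι)}

/-- If `⟨θ, T⟩` vanishes, then so does the exponent of `T` at `θ`; its real part is the integral of
`cos ⟨θ, ·⟩ - 1 ≤ 0` over the Lévy measure, so that `cos ⟨θ, ·⟩ = 1` almost everywhere. -/
lemma IsSubordinator.exponent_eq_zero_and_ae_cos_eq_one (hT : IsSubordinator T P d τ) {θ : E ι}
    (h : ∀ t, ∀ᵐ ω ∂P, (inner ℝ θ (T t ω) : ℝ) = 0) :
    (Complex.I * (inner ℝ θ d : ℝ)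
        + ∫ s, (Complex.exp (Complex.I * (inner ℝ θ s : ℝ)) - 1) ∂τ = 0) ∧
      ∀ᵐ s ∂τ, Real.cos (inner ℝ θ s) = 1 := by
  have h1 : Complex.I * (inner ℝ θ d : ℝ)
        + ∫ s, (Complex.exp (Complex.I * (inner ℝ θ s : ℝ)) - 1) ∂τ = 0 := by
    rw [← hT.levyExponent_eq]
    refine eq_of_forall_exp_mul_eq fun t => ?_
    rw [← hT.triplet.charFun_eq, charFun_map_eq (hT.triplet.levy.aemeasurable t),
      mul_zero, Complex.exp_zero]
    have h2 : ∫ ω, Complex.exp (Complex.I * (inner ℝ θ (T t ω) : ℝ)) ∂P = ∫ _, (1 : ℂ) ∂P := by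
      refine integral_congr_ae ?_
      filter_upwards [h t] with ω hω
      simp [hω]
    rw [h2]
    simp
  refine ⟨h1, ?_⟩
  have hint : Integrable (fun s => Complex.exp (Complex.I * (inner ℝ θ s : ℝ)) - 1) τ := by
    refine (hT.integrable_min_norm.const_mul (2 * (1 + ‖θ‖))).mono' (by fun_prop)
      (ae_of_all _ fun s => ?_)
    refine (norm_exp_sub_one_le_of_re_nonpos (by simp)).trans ?_
    rw [norm_mul, Complex.norm_I, one_mul, Complex.norm_real, Real.norm_eq_abs, mul_assoc]
    gcongr
    rw [mul_min_of_nonneg _ _ (by positivity)]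
    refine min_le_min ((abs_real_inner_le_norm θ s).trans ?_) (by linarith [norm_nonneg θ])
    nlinarith [norm_nonneg s]
  have hcos : ∀ s, (Complex.exp (Complex.I * (inner ℝ θ s : ℝ)) - 1).re
      = Real.cos (inner ℝ θ s) - 1 := by
    intro s
    rw [mul_comm, Complex.sub_re, Complex.exp_ofReal_mul_I_re, Complex.one_re]
  have h3 : ∫ s, (1 - Real.cos (inner ℝ θ s)) ∂τ = 0 := by
    have h4 := congrArg Complex.re h1
    have h5 := integral_re hint
    simp only [RCLike.re_eq_complex_re] at h5
    rw [Complex.add_re, ← h5] at h4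
    simp_rw [hcos] at h4
    have h6 : ∫ s, (1 - Real.cos (inner ℝ θ s)) ∂τ
        = -∫ s, (Real.cos (inner ℝ θ s) - 1) ∂τ := by
      rw [← integral_neg]
      simp
    rw [h6]
    simpa using h4
  have hint2 : Integrable (fun s => 1 - Real.cos (inner ℝ θ s)) τ := by
    have := hint.re.neg
    simp only [RCLike.re_eq_complex_re, hcos] at this
    exact this.congr (ae_of_all _ fun s => by simp)
  have h7 := (integral_eq_zero_iff_of_nonneg (fun s => by
    simpa using Real.cos_le_one _) hint2).1 h3
  filter_upwards [h7] with s hs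
  simp only [Pi.zero_apply] at hs
  linarith

/-- A subordinator whose components are indistinguishable has its drift and its jumps on the
diagonal. -/
lemma IsSubordinator.diagonal (hT : IsSubordinator T P d τ)
    (h : HasIndistinguishableComponents T P) :
    d ∈ diagonalTimes ι ∧ ∀ᵐ s ∂τ, s ∈ diagonalTimes ι := by
  classical
  have hinner : ∀ (N : ℕ) (k l : ι) (x : E ι), (inner ℝ
      ((1 / ((N : ℝ) + 1)) • (EuclideanSpace.single k (1 : ℝ) - EuclideanSpace.single l 1)) x : ℝ)
      = (1 / ((N : ℝ) + 1)) * (x k - x l) := by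
    intro N k l x
    rw [inner_smul_left, inner_sub_left, EuclideanSpace.inner_single_left,
      EuclideanSpace.inner_single_left]
    simp
  have hmain := fun (N : ℕ) (k l : ι) => hT.exponent_eq_zero_and_ae_cos_eq_one
    (θ := (1 / ((N : ℝ) + 1)) • (EuclideanSpace.single k (1 : ℝ) - EuclideanSpace.single l 1))
    (fun t => by
      filter_upwards [h] with ω hω
      rw [hinner, hω t k l, sub_self, mul_zero])
  simp_rw [hinner] at hmain
  have hτ : ∀ᵐ s ∂τ, ∀ k l, s k = s l := by
    rw [ae_all_iff]
    intro k
    rw [ae_all_iff]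
    intro l
    filter_upwards [ae_all_iff.2 fun N => (hmain N k l).2] with s hs
    -- for large `N`, the only multiple of `2π` that `(s k - s l) / (N + 1)` can be is `0`
    obtain ⟨N, hN⟩ := exists_nat_gt |s k - s l|
    have hN0 : (0 : ℝ) < N + 1 := by positivity
    have hlt : |1 / ((N : ℝ) + 1) * (s k - s l)| < 1 := by
      rw [abs_mul, abs_of_pos (by positivity), one_div, inv_mul_lt_iff₀ hN0]
      linarith
    have hpi := Real.pi_gt_three
    rw [abs_lt] at hlt
    have h0 := (Real.cos_eq_one_iff_of_lt_of_lt (by linarith) (by linarith)).1 (hs N)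
    have := (mul_eq_zero.1 h0).resolve_left (by positivity)
    linarith
  refine ⟨⟨hT.drift_nonneg, fun k l => ?_⟩, hT.ae_nonneg_levyMeasure.and hτ⟩
  have h1 := (hmain 0 k l).1
  have h2 : ∫ s : E ι, (Complex.exp (Complex.I *
      ((1 / (((0 : ℕ) : ℝ) + 1) * (s k - s l) : ℝ) : ℂ)) - 1) ∂τ = 0 := by
    refine (integral_congr_ae ?_).trans (integral_zero _ _)
    filter_upwards [hτ] with s hs
    simp [hs k l]
  rw [h2] at h1
  have h3 : (d k : ℂ) - d l = 0 := by simpa using h1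
  exact_mod_cast sub_eq_zero.1 h3

end Diagonal

/-! ### The pair of the time change and the time-changed process -/

section Pair

variable {ι : Type*}

/-- The time coordinates `θ₁` of `θ = (θ₁, θ₂) ∈ ℝ^{2n}`. -/
def timePart (θ : E (ι ⊕ ι)) : E ι := WithLp.toLp 2 fun k => θ (Sum.inl k)

/-- The space coordinates `θ₂` of `θ = (θ₁, θ₂) ∈ ℝ^{2n}`. -/
def spacePart (θ : E (ι ⊕ ι)) : E ι := WithLp.toLp 2 fun k => θ (Sum.inr k)

lemma pair_sub_pair (a x b y : E ι) : pair a x - pair b y = pair (a - b) (x - y) := by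
  ext (k | k) <;> simp [pair]

lemma pair_zero_zero : pair (0 : E ι) 0 = 0 := by
  ext (k | k) <;> simp [pair]

lemma left_eq_zero_of_pair_eq_zero {t x : E ι} (h : pair t x = 0) : t = 0 := by
  ext k
  simpa [pair] using congrArg (fun z : E (ι ⊕ ι) => z (Sum.inl k)) h

lemma right_eq_zero_of_pair_eq_zero {t x : E ι} (h : pair t x = 0) : x = 0 := by
  ext k
  simpa [pair] using congrArg (fun z : E (ι ⊕ ι) => z (Sum.inr k)) h

@[fun_prop]
lemma Measurable.pair {α : Type*} {mα : MeasurableSpace α} {f g : α → E ι} (hf : Measurable f)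
    (hg : Measurable g) : Measurable fun a => pair (f a) (g a) := by
  have h : Measurable fun a => (Sum.elim (fun k => f a k) (fun k => g a k) : ι ⊕ ι → ℝ) := by
    refine measurable_pi_lambda _ ?_
    rintro (k | k)
    · simp only [Sum.elim_inl]; fun_prop
    · simp only [Sum.elim_inr]; fun_prop
  exact (WithLp.measurable_toLp 2 _).comp h

variable [Fintype ι]

lemma inner_pair (θ : E (ι ⊕ ι)) (t x : E ι) :
    (inner ℝ θ (pair t x) : ℝ) = inner ℝ (timePart θ) t + inner ℝ (spacePart θ) x := by
  simp [PiLp.inner_apply, pair, timePart, spacePart]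

lemma norm_pair_sq (t x : E ι) : ‖pair t x‖ ^ 2 = ‖t‖ ^ 2 + ‖x‖ ^ 2 := by
  simp [EuclideanSpace.norm_sq_eq, pair]

lemma norm_pair_zero (x : E ι) : ‖pair 0 x‖ = ‖x‖ := by
  have h := norm_pair_sq 0 x
  rw [norm_zero, zero_pow two_ne_zero, zero_add] at h
  exact (pow_left_inj₀ (norm_nonneg _) (norm_nonneg _) two_ne_zero).1 h

lemma norm_left_le_norm_pair (t x : E ι) : ‖t‖ ≤ ‖pair t x‖ :=
  le_of_sq_le_sq (by rw [norm_pair_sq]; nlinarith [sq_nonneg ‖x‖]) (norm_nonneg _)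

lemma norm_right_le_norm_pair (t x : E ι) : ‖x‖ ≤ ‖pair t x‖ :=
  le_of_sq_le_sq (by rw [norm_pair_sq]; nlinarith [sq_nonneg ‖t‖]) (norm_nonneg _)

end Pair

section Subordination

variable {ι Ω : Type*} [Fintype ι] {mΩ : MeasurableSpace Ω} {P : Measure Ω}

/-- The coefficients of the linear function `t ↦ i⟨θ₁, t⟩ + ∑ₖ u(θ₂)ₖ tₖ`. -/
def pairCoeff (u : E ι → ι → ℂ) (θ : E (ι ⊕ ι)) (k : ι) : ℂ :=
  Complex.I * θ (Sum.inl k) + u (spacePart θ) k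

lemma sum_pairCoeff_mul (u : E ι → ι → ℂ) (θ : E (ι ⊕ ι)) (t : E ι) :
    ∑ k, pairCoeff u θ k * t k
      = Complex.I * (inner ℝ (timePart θ) t : ℝ) + ∑ k, u (spacePart θ) k * t k := by
  simp only [pairCoeff, add_mul, Finset.sum_add_distrib, PiLp.inner_apply, timePart,
    Complex.ofReal_sum, Finset.mul_sum]
  congr 1
  refine Finset.sum_congr rfl fun k _ => ?_
  simp
  ring

/-- The exponent of the pair `(T, X ∘ T)`: the Laplace exponent of `T` evaluated at the linear
exponent of `(t, X(t))`. -/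
def pairExponent (u : E ι → ι → ℂ) (d : E ι) (τ : Measure (E ι)) (θ : E (ι ⊕ ι)) : ℂ :=
  ∑ k, pairCoeff u θ k * d k + ∫ s, (Complex.exp (∑ k, pairCoeff u θ k * s k) - 1) ∂τ

/-- A Lévy process and an independent subordinator with regular paths such that the times taken by
the subordinator lie in a set on which the exponent of the Lévy process is linear. -/
structure IsLinearTimeChange (X T : ℝ≥0 → Ω → E ι) (P : Measure Ω) (d : E ι) (τ : Measure (E ι))
    (A : Set (E ι)) (u : E ι → ι → ℂ) : Prop where
  measurable_process : ∀ t, Measurable (X t)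
  cadlag_process : ∀ ω, IsCadlagPath fun t => X t ω
  process_zero : ∀ ω, X 0 ω = 0
  subordinator : IsSubordinator T P d τ
  measurable_time : ∀ t, Measurable (T t)
  cadlag_time : ∀ ω, IsCadlagPath fun t => T t ω
  monotone_time : ∀ ω k, Monotone fun t => T t ω k
  time_zero : ∀ ω, T 0 ω = 0
  time_mem : ∀ ω t, T t ω ∈ A
  nonneg_of_mem : ∀ s ∈ A, ∀ k, 0 ≤ s k
  indep : IndepFun (fun ω (t : ℝ≥0) => T t ω) (fun ω (t : ℝ≥0) => X t ω) P
  linear : HasLinearExponent X P A u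
  re_nonpos : ∀ θ k, (u θ k).re ≤ 0

variable {X T : ℝ≥0 → Ω → E ι} {d : E ι} {τ : Measure (E ι)} {A : Set (E ι)}
  {u : E ι → ι → ℂ}

lemma IsLinearTimeChange.zero_mem [IsProbabilityMeasure P]
    (h : IsLinearTimeChange X T P d τ A u) : 0 ∈ A := by
  obtain ⟨ω⟩ := nonempty_of_isProbabilityMeasure P
  have := h.time_mem ω 0
  rwa [h.time_zero] at this

lemma IsLinearTimeChange.measurable_multiEval (h : IsLinearTimeChange X T P d τ A u) :
    Measurable fun p : E ι × Ω => multiEval X p.1 p.2 :=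
  WeakSubordination.measurable_multiEval h.measurable_process h.cadlag_process

lemma IsLinearTimeChange.re_pairCoeff_nonpos (h : IsLinearTimeChange X T P d τ A u)
    (θ : E (ι ⊕ ι)) (k : ι) : (pairCoeff u θ k).re ≤ 0 := by
  simpa [pairCoeff] using h.re_nonpos (spacePart θ) k

/-- Freezing the time change at the values taken along a chain of times and integrating over `X`
leaves an exponential of a linear function of the increments of the time change. -/
lemma IsLinearTimeChange.integral_exp_increments_eq_time [IsProbabilityMeasure P]
    (h : IsLinearTimeChange X T P d τ A u) {m : ℕ} {r : Fin (m + 1) → ℝ≥0} (hr : Monotone r)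
    (θ : Fin m → E (ι ⊕ ι)) :
    ∫ ω, Complex.exp (Complex.I * ((∑ j, inner ℝ (θ j)
        (pair (T (r j.succ) ω) (subordinate X T (r j.succ) ω)
          - pair (T (r j.castSucc) ω) (subordinate X T (r j.castSucc) ω)) : ℝ) : ℂ)) ∂P
      = ∫ ω, ∏ j, Complex.exp (∑ k, pairCoeff u (θ j) k
          * ((T (r j.succ) ω - T (r j.castSucc) ω) k : ℝ)) ∂P := by
  -- `X` enters through its random path: evaluation is jointly measurable on the space of càdlàg
  -- paths, while it is not on the space of all functions
  set V : Ω → Fin (m + 1) → E ι := fun ω j => T (r j) ω with hV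
  set W : Ω → CadlagPath ι := fun ω => ⟨fun t => X t ω, h.cadlag_process ω⟩ with hW
  set G : (Fin (m + 1) → E ι) × CadlagPath ι → ℂ := fun p =>
    Complex.exp (Complex.I * ((∑ j : Fin m, inner ℝ (θ j)
      (pair (p.1 j.succ) (multiEval canonicalProcess (p.1 j.succ) p.2)
        - pair (p.1 j.castSucc) (multiEval canonicalProcess (p.1 j.castSucc) p.2)) : ℝ) : ℂ))
    with hG
  have hVm : Measurable V := measurable_pi_lambda _ fun j => h.measurable_time _
  have hWm' : Measurable fun ω (t : ℝ≥0) => X t ω := measurable_pi_lambda _ h.measurable_process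
  have hWm : Measurable W := hWm'.subtype_mk
  have hind : IndepFun V W P := by
    have h1 : IndepFun (fun ω (t : ℝ≥0) => T t ω) W P := by
      rw [IndepFun_iff_Indep] at *
      have h2 := (IndepFun_iff_Indep _ _ _).1 h.indep
      have h3 : MeasurableSpace.comap W inferInstance
          = MeasurableSpace.comap (fun ω (t : ℝ≥0) => X t ω) MeasurableSpace.pi := by
        rw [show (inferInstance : MeasurableSpace (CadlagPath ι))
          = MeasurableSpace.comap Subtype.val MeasurableSpace.pi from rfl,
          MeasurableSpace.comap_comp]
        rfl
      rwa [h3]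
    exact h1.comp (φ := fun f j => f (r j)) (ψ := id)
      (measurable_pi_lambda _ fun j => measurable_pi_apply _) measurable_id
  have hme : ∀ i, Measurable fun p : (Fin (m + 1) → E ι) × CadlagPath ι =>
      multiEval canonicalProcess (p.1 i) p.2 := fun i =>
    measurable_multiEval_canonicalProcess.comp
      (f := fun p : (Fin (m + 1) → E ι) × CadlagPath ι => (p.1 i, p.2)) (by fun_prop)
  have hGm : Measurable G := by
    have : ∀ i, Measurable fun p : (Fin (m + 1) → E ι) × CadlagPath ι =>
      pair (p.1 i) (multiEval canonicalProcess (p.1 i) p.2) := fun i =>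
        Measurable.pair (by fun_prop) (hme i)
    fun_prop
  have hfreeze := integral_comp_of_indepFun hVm hWm hind hGm (C := 1)
    (fun p => norm_exp_I_mul_ofReal_le_one _)
  refine hfreeze.trans (integral_congr_ae (ae_of_all _ fun ω => ?_))
  have hlin := h.linear m (fun j => T (r j) ω) (fun j => h.time_mem ω _)
    (fun k i j hij => h.monotone_time ω k (hr hij)) fun j => spacePart (θ j)
  have hsplit : ∀ ω', G (V ω, W ω') = Complex.exp (Complex.I * ((∑ j : Fin m,
      inner ℝ (timePart (θ j)) (T (r j.succ) ω - T (r j.castSucc) ω) : ℝ) : ℂ))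
      * Complex.exp (Complex.I * ((∑ j : Fin m, inner ℝ (spacePart (θ j))
        (multiEval X (T (r j.succ) ω) ω' - multiEval X (T (r j.castSucc) ω) ω') : ℝ) : ℂ)) := by
    intro ω'
    rw [← Complex.exp_add, ← mul_add, ← Complex.ofReal_add, ← Finset.sum_add_distrib]
    simp only [hG, pair_sub_pair, inner_pair]
    rfl
  simp only [hsplit]
  rw [integral_const_mul, hlin, Complex.ofReal_sum, Finset.mul_sum, Complex.exp_sum,
    ← Finset.prod_mul_distrib]
  refine Finset.prod_congr rfl fun j _ => ?_
  rw [← Complex.exp_add, sum_pairCoeff_mul]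
  simp

/-- The increments of `(T, X ∘ T)` along a chain of times are independent and their characteristic
functions come from the exponent `pairExponent`. -/
lemma IsLinearTimeChange.integral_exp_increments [IsProbabilityMeasure P]
    (h : IsLinearTimeChange X T P d τ A u) {m : ℕ} {r : Fin (m + 1) → ℝ≥0} (hr : Monotone r)
    (θ : Fin m → E (ι ⊕ ι)) :
    ∫ ω, Complex.exp (Complex.I * ((∑ j, inner ℝ (θ j)
        (pair (T (r j.succ) ω) (subordinate X T (r j.succ) ω)
          - pair (T (r j.castSucc) ω) (subordinate X T (r j.castSucc) ω)) : ℝ) : ℂ)) ∂P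
      = ∏ j, Complex.exp (((r j.succ : ℝ) - (r j.castSucc : ℝ) : ℝ)
          * pairExponent u d τ (θ j)) := by
  set f : Fin m → E ι → ℂ := fun j y => Complex.exp (∑ k, pairCoeff u (θ j) k * (y k : ℝ))
    with hfdef
  have hf : ∀ j, Measurable (f j) := fun j => by fun_prop
  have hprod : ∫ ω, ∏ j, f j (T (r j.succ) ω - T (r j.castSucc) ω) ∂P
      = ∏ j, ∫ ω, f j (T (r j.succ) ω - T (r j.castSucc) ω) ∂P :=
    (h.subordinator.triplet.levy.indep m r hr).integral_fun_prod_comp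
      (fun j => ((h.measurable_time _).sub (h.measurable_time _)).aemeasurable)
      (fun j => (hf j).aestronglyMeasurable)
  rw [h.integral_exp_increments_eq_time hr]
  refine hprod.trans (Finset.prod_congr rfl fun j _ => ?_)
  have hle : r j.castSucc ≤ r j.succ := hr (Fin.castSucc_le_succ j)
  have hst := h.subordinator.triplet.levy.stationary (r j.castSucc) (r j.succ - r j.castSucc)
  rw [add_tsub_cancel_of_le hle] at hst
  have h1 : ∫ ω, f j (T (r j.succ) ω - T (r j.castSucc) ω) ∂P
      = ∫ ω, f j (T (r j.succ - r j.castSucc) ω) ∂P := (hst.comp (hf j)).integral_eq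
  have h2 := h.subordinator.integral_exp (h.re_pairCoeff_nonpos (θ j)) (r j.succ - r j.castSucc)
  rw [NNReal.coe_sub hle] at h2
  rw [h1, pairExponent, ← h2]

lemma IsLinearTimeChange.measurable_pair (h : IsLinearTimeChange X T P d τ A u) (t : ℝ≥0) :
    Measurable fun ω => pair (T t ω) (subordinate X T t ω) := by
  have h1 : Measurable fun ω => multiEval X (T t ω) ω :=
    h.measurable_multiEval.comp ((h.measurable_time t).prodMk measurable_id)
  exact Measurable.pair (h.measurable_time t) h1

/-- `(T, X ∘ T)` is a Lévy process with exponent `pairExponent`. -/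
lemma IsLinearTimeChange.isLevyProcess_pair [IsProbabilityMeasure P]
    (h : IsLinearTimeChange X T P d τ A u) :
    IsLevyProcess (fun t ω => pair (T t ω) (subordinate X T t ω)) P ∧
      ∀ t θ, charFun (P.map fun ω => pair (T t ω) (subordinate X T t ω)) θ
        = Complex.exp ((t : ℝ) * pairExponent u d τ θ) :=
  isLevyProcess_of_integral_exp_increments (fun t => (h.measurable_pair t).aemeasurable)
    (ae_of_all _ fun ω => by
      rw [subordinate, h.time_zero, multiEval_zero (h.process_zero ω), pair_zero_zero])
    (ae_of_all _ fun ω => isCadlagPath_pair_multiEval (h.cadlag_process ω) (h.cadlag_time ω)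
      (h.monotone_time ω)) _ fun _ _ hr θ => h.integral_exp_increments hr θ

/-- The characteristic function of `(s, X(s))` at the times `s ∈ A`. -/
lemma IsLinearTimeChange.integral_exp_pair [IsProbabilityMeasure P]
    (h : IsLinearTimeChange X T P d τ A u) {s : E ι} (hs : s ∈ A) (θ : E (ι ⊕ ι)) :
    ∫ ω, Complex.exp (Complex.I * (inner ℝ θ (pair s (multiEval X s ω)) : ℝ)) ∂P
      = Complex.exp (∑ k, pairCoeff u θ k * s k) := by
  simp_rw [inner_pair, Complex.ofReal_add, mul_add, Complex.exp_add]
  rw [integral_const_mul, h.linear.integral_exp_multiEval (ae_of_all _ h.process_zero)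
    h.zero_mem hs (h.nonneg_of_mem s hs), sum_pairCoeff_mul, Complex.exp_add]

end Subordination

/-! ### Small-time moments of a Lévy process -/

section Moments

lemma min_sq_one_le (x : ℝ) : min (x ^ 2) 1 ≤ 3 * (1 - Real.exp (-x ^ 2 / 2)) := by
  set y := x ^ 2 / 2 with hy
  have hy0 : 0 ≤ y := by positivity
  have h1 : Real.exp (-x ^ 2 / 2) ≤ 1 / (1 + y) := by
    rw [show -x ^ 2 / 2 = -y by rw [hy]; ring, Real.exp_neg, ← one_div]
    exact one_div_le_one_div_of_le (by positivity) (by linarith [Real.add_one_le_exp y])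
  have h2 : 1 - 1 / (1 + y) = y / (1 + y) := by field_simp; ring
  have h3 : min (x ^ 2) 1 ≤ 3 * (y / (1 + y)) := by
    rw [← mul_div_assoc, le_div_iff₀ (by positivity)]
    rcases le_total (x ^ 2) 1 with h | h
    · rw [min_eq_left h]; nlinarith
    · rw [min_eq_right h]; nlinarith
  linarith

lemma integral_cos_gaussianReal (x : ℝ) :
    ∫ r, (1 - Real.cos (r * x)) ∂(gaussianReal 0 1) = 1 - Real.exp (-x ^ 2 / 2) := by
  have h1 := charFun_gaussianReal (μ := 0) (v := 1) x
  rw [charFun_apply_real] at h1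
  have hint : Integrable (fun r : ℝ => Complex.exp (x * r * Complex.I)) (gaussianReal 0 1) := by
    refine Integrable.of_bound (C := 1) (by fun_prop) (ae_of_all _ fun r => ?_)
    rw [← Complex.ofReal_mul, Complex.norm_exp_ofReal_mul_I]
  have h2 := integral_re hint
  rw [h1] at h2
  have h3 : ∀ r : ℝ, (Complex.exp (x * r * Complex.I)).re = Real.cos (r * x) := fun r => by
    rw [← Complex.ofReal_mul, Complex.exp_ofReal_mul_I_re, mul_comm]
  have h4 : (Complex.exp (x * (0 : ℝ) * Complex.I - ((1 : ℝ≥0) : ℝ) * x ^ 2 / 2)).re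
      = Real.exp (-x ^ 2 / 2) := by
    rw [← Complex.exp_ofReal_re]
    congr 2
    push_cast
    ring
  have hcos : Integrable (fun r : ℝ => Real.cos (r * x)) (gaussianReal 0 1) :=
    Integrable.of_bound (C := 1) (by fun_prop) (ae_of_all _ fun r => Real.abs_cos_le_one _)
  rw [integral_sub (integrable_const 1) hcos]
  simp only [RCLike.re_eq_complex_re, h3] at h2
  rw [h2, h4]
  simp

lemma integrable_one_add_sq_gaussianReal :
    Integrable (fun r : ℝ => 1 + r ^ 2) (gaussianReal 0 1) := by
  have h := (memLp_id_gaussianReal (μ := 0) (v := 1) 2).integrable_sq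
  exact (integrable_const 1).add h

lemma abs_sin_sub_self_le (x : ℝ) : |Real.sin x - x| ≤ 3 * x ^ 2 := by
  have h1 := norm_exp_I_mul_sub_one_sub_le x
  refine (le_of_eq ?_).trans ((Complex.abs_im_le_norm _).trans h1)
  rw [mul_comm]
  simp [Complex.exp_ofReal_mul_I_im]

lemma _root_.Measurable.euclidean_apply {α ι : Type*} {mα : MeasurableSpace α} {f : α → E ι}
    (hf : Measurable f) (k : ι) : Measurable fun a => f a k := by
  fun_prop

lemma norm_le_sum_abs_apply {ι : Type*} [Fintype ι] (x : E ι) : ‖x‖ ≤ ∑ k, |x k| := by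
  refine le_of_sq_le_sq ?_ (by positivity)
  rw [EuclideanSpace.norm_sq_eq]
  exact Finset.sum_sq_le_sq_sum_of_nonneg fun k _ => by positivity

variable {ι Ω : Type*} [Fintype ι] {mΩ : MeasurableSpace Ω} {P : Measure Ω}
  {X : ℝ≥0 → Ω → E ι} {μ : E ι} {S : Matrix ι ι ℝ} {ν : Measure (E ι)}

/-- The marginal characteristic functions of a Lévy process are at distance `O(t)` from `1`,
locally uniformly. -/
lemma HasTriplet.exists_norm_charFun_sub_one_le [IsProbabilityMeasure P]
    (hX : HasTriplet X P μ S ν) : ∃ C, 0 ≤ C ∧ ∀ (k : ι) (t : ℝ≥0) (r : ℝ),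
      ‖∫ ω, Complex.exp (Complex.I * ((r * X t ω k : ℝ) : ℂ)) ∂P - 1‖
        ≤ C * (1 + r ^ 2) * t := by
  classical
  obtain ⟨C, hC0, hC⟩ := exists_norm_levyExponent_le μ S hX.levyMeasure
  refine ⟨2 * C, by positivity, fun k t r => ?_⟩
  have h1 := hX.charFun_eq t (EuclideanSpace.single k r)
  rw [charFun_map_eq (hX.levy.aemeasurable t)] at h1
  simp only [EuclideanSpace.inner_single_left, conj_trivial] at h1
  rw [h1]
  have h2 := hX.levyExponent_re_nonpos (EuclideanSpace.single k r)
  refine (norm_exp_sub_one_le_of_re_nonpos ?_).trans ?_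
  · rw [Complex.re_ofReal_mul]
    exact mul_nonpos_of_nonneg_of_nonpos t.2 h2
  · have h3 := hC (EuclideanSpace.single k r)
    rw [PiLp.norm_single, Real.norm_eq_abs, sq_abs] at h3
    rw [norm_mul, Complex.norm_real, Real.norm_of_nonneg (NNReal.coe_nonneg t)]
    have h4 : (t : ℝ) * ‖levyExponent μ S ν (EuclideanSpace.single k r)‖
        ≤ t * (C * (1 + r ^ 2)) := mul_le_mul_of_nonneg_left h3 (NNReal.coe_nonneg t)
    have h5 := min_le_left ((t : ℝ) * ‖levyExponent μ S ν (EuclideanSpace.single k r)‖) 1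
    linarith

/-- The truncated second moments of a Lévy process are `O(t)`: average the bound on the
characteristic function against a standard Gaussian. -/
lemma HasTriplet.exists_integral_min_sq_le [IsProbabilityMeasure P]
    (hX : HasTriplet X P μ S ν) (hXm : ∀ t, Measurable (X t)) :
    ∃ C, 0 ≤ C ∧ ∀ (k : ι) (t : ℝ≥0), ∫ ω, min ((X t ω k) ^ 2) 1 ∂P ≤ C * t := by
  obtain ⟨C, hC0, hC⟩ := hX.exists_norm_charFun_sub_one_le
  set M := ∫ r : ℝ, (1 + r ^ 2) ∂(gaussianReal 0 1) with hM
  have hM0 : 0 ≤ M := integral_nonneg fun r => by positivity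
  refine ⟨3 * (C * M), by positivity, fun k t => ?_⟩
  have hk : Measurable fun ω => X t ω k := by
    have := hXm t
    fun_prop
  have hcos : ∀ r : ℝ, ∫ ω, (1 - Real.cos (r * X t ω k)) ∂P ≤ C * t * (1 + r ^ 2) := by
    intro r
    have hint : Integrable (fun ω => Complex.exp (Complex.I * ((r * X t ω k : ℝ) : ℂ))) P :=
      Integrable.of_bound (C := 1) (by fun_prop)
        (ae_of_all _ fun ω => norm_exp_I_mul_ofReal_le_one _)
    have hre := integral_re hint
    have h1 : ∀ ω, (Complex.exp (Complex.I * ((r * X t ω k : ℝ) : ℂ))).re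
        = Real.cos (r * X t ω k) := fun ω => by rw [mul_comm, Complex.exp_ofReal_mul_I_re]
    simp only [RCLike.re_eq_complex_re, h1] at hre
    have hci : Integrable (fun ω => Real.cos (r * X t ω k)) P :=
      Integrable.of_bound (C := 1) (by fun_prop) (ae_of_all _ fun ω => Real.abs_cos_le_one _)
    rw [integral_sub (integrable_const 1) hci, hre]
    have h2 := (neg_le_abs _).trans ((Complex.abs_re_le_norm _).trans (hC k t r))
    rw [Complex.sub_re, Complex.one_re] at h2
    simp only [integral_const, probReal_univ, smul_eq_mul, one_mul]
    linarith
  have hswap : ∫ ω, (1 - Real.exp (-(X t ω k) ^ 2 / 2)) ∂P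
      = ∫ r : ℝ, ∫ ω, (1 - Real.cos (r * X t ω k)) ∂P ∂(gaussianReal 0 1) := by
    simp_rw [← integral_cos_gaussianReal]
    refine integral_integral_swap (f := fun ω r => 1 - Real.cos (r * X t ω k)) ?_
    refine Integrable.of_bound (C := 2) ?_ (ae_of_all _ fun p => ?_)
    · simp only [Function.uncurry_def]
      have : Measurable fun p : Ω × ℝ => X t p.1 k := hk.comp measurable_fst
      fun_prop
    · simp only [Function.uncurry]
      rw [Real.norm_eq_abs, abs_le]
      constructor <;> linarith [Real.cos_le_one (p.2 * X t p.1 k),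
        Real.neg_one_le_cos (p.2 * X t p.1 k)]
  have hle : ∫ r : ℝ, ∫ ω, (1 - Real.cos (r * X t ω k)) ∂P ∂(gaussianReal 0 1)
      ≤ C * t * M := by
    rw [hM, ← integral_const_mul]
    refine integral_mono_of_nonneg (ae_of_all _ fun r => ?_)
      (integrable_one_add_sq_gaussianReal.const_mul _) (ae_of_all _ hcos)
    exact integral_nonneg fun ω => sub_nonneg.2 (Real.cos_le_one _)
  have hexp : Integrable (fun ω => 3 * (1 - Real.exp (-(X t ω k) ^ 2 / 2))) P := by
    refine Integrable.of_bound (C := 3) (by fun_prop) (ae_of_all _ fun ω => ?_)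
    have h1 : Real.exp (-(X t ω k) ^ 2 / 2) ≤ 1 := Real.exp_le_one_iff.2 (by
      have := sq_nonneg (X t ω k); linarith)
    have h2 := Real.exp_pos (-(X t ω k) ^ 2 / 2)
    rw [Real.norm_eq_abs, abs_le]
    constructor <;> linarith
  calc ∫ ω, min ((X t ω k) ^ 2) 1 ∂P
      ≤ ∫ ω, 3 * (1 - Real.exp (-(X t ω k) ^ 2 / 2)) ∂P :=
        integral_mono_of_nonneg (ae_of_all _ fun ω => by positivity) hexp
          (ae_of_all _ fun ω => min_sq_one_le _)
    _ ≤ 3 * (C * M) * t := by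
        rw [integral_const_mul, hswap]
        linarith

lemma HasTriplet.exists_abs_integral_sin_le [IsProbabilityMeasure P]
    (hX : HasTriplet X P μ S ν) (hXm : ∀ t, Measurable (X t)) :
    ∃ C, 0 ≤ C ∧ ∀ (k : ι) (t : ℝ≥0), |∫ ω, Real.sin (X t ω k) ∂P| ≤ C * t := by
  obtain ⟨C, hC0, hC⟩ := hX.exists_norm_charFun_sub_one_le
  refine ⟨C * 2, by positivity, fun k t => ?_⟩
  have hk : Measurable fun ω => X t ω k := by
    have := hXm t
    fun_prop
  have hint : Integrable (fun ω => Complex.exp (Complex.I * ((1 * X t ω k : ℝ) : ℂ))) P :=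
    Integrable.of_bound (C := 1) (by fun_prop)
      (ae_of_all _ fun ω => norm_exp_I_mul_ofReal_le_one _)
  have him := integral_im hint
  have h1 : ∀ ω, (Complex.exp (Complex.I * ((1 * X t ω k : ℝ) : ℂ))).im
      = Real.sin (X t ω k) := fun ω => by
    rw [mul_comm, Complex.exp_ofReal_mul_I_im, one_mul]
  simp only [RCLike.im_eq_complex_im, h1] at him
  have h2 := (Complex.abs_im_le_norm _).trans (hC k t 1)
  rw [Complex.sub_im, Complex.one_im, sub_zero, ← him] at h2
  calc _ ≤ _ := h2
    _ = _ := by ring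

/-- The part of `X(s)` for which `(s, X(s))` stays in the unit ball. -/
def truncatedEval (X : ℝ≥0 → Ω → E ι) (s : E ι) : Ω → E ι :=
  {ω' | pair s (multiEval X s ω') ∈ unitBall (ι ⊕ ι)}.indicator (multiEval X s)

lemma truncatedEval_of_mem {s : E ι} {ω : Ω}
    (h : pair s (multiEval X s ω) ∈ unitBall (ι ⊕ ι)) :
    truncatedEval X s ω = multiEval X s ω :=
  Set.indicator_of_mem (s := {ω' | pair s (multiEval X s ω') ∈ unitBall (ι ⊕ ι)}) h _

lemma truncatedEval_of_notMem {s : E ι} {ω : Ω}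
    (h : pair s (multiEval X s ω) ∉ unitBall (ι ⊕ ι)) : truncatedEval X s ω = 0 :=
  Set.indicator_of_notMem (s := {ω' | pair s (multiEval X s ω') ∈ unitBall (ι ⊕ ι)}) h _

lemma norm_truncatedEval_le_one (s : E ι) (ω : Ω) : ‖truncatedEval X s ω‖ ≤ 1 := by
  by_cases h : pair s (multiEval X s ω) ∈ unitBall (ι ⊕ ι)
  · rw [truncatedEval_of_mem h]
    exact (norm_right_le_norm_pair _ _).trans h
  · rw [truncatedEval_of_notMem h, norm_zero]
    exact zero_le_one

lemma abs_truncatedEval_sub_sin_le (s : E ι) (ω : Ω) (k : ι) :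
    |truncatedEval X s ω k - Real.sin (multiEval X s ω k)|
      ≤ 3 * min (‖pair s (multiEval X s ω)‖ ^ 2) 1 := by
  by_cases h : pair s (multiEval X s ω) ∈ unitBall (ι ⊕ ι)
  · have h1 : ‖pair s (multiEval X s ω)‖ ≤ 1 := h
    rw [truncatedEval_of_mem h, abs_sub_comm, min_eq_left (by
      nlinarith [norm_nonneg (pair s (multiEval X s ω))])]
    refine (abs_sin_sub_self_le _).trans ?_
    rw [← sq_abs]
    have := (abs_apply_le_norm (multiEval X s ω) k).trans (norm_right_le_norm_pair s _)
    gcongr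
  · have h1 : 1 < ‖pair s (multiEval X s ω)‖ := not_le.1 h
    rw [truncatedEval_of_notMem h, min_eq_right (by nlinarith)]
    have := Real.abs_sin_le_one (multiEval X s ω k)
    simp only [PiLp.zero_apply, zero_sub, abs_neg]
    linarith

variable [IsProbabilityMeasure P]

lemma measurable_truncatedEval (hm : Measurable fun p : E ι × Ω => multiEval X p.1 p.2) :
    Measurable fun p : E ι × Ω => truncatedEval X p.1 p.2 := by
  have h1 : MeasurableSet {p : E ι × Ω | pair p.1 (multiEval X p.1 p.2) ∈ unitBall (ι ⊕ ι)} :=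
    (Measurable.pair measurable_fst hm) measurableSet_unitBall
  exact hm.indicator h1

lemma HasTriplet.exists_integral_min_norm_pair_le (hX : HasTriplet X P μ S ν)
    (hXm : ∀ t, Measurable (X t)) (hm : Measurable fun p : E ι × Ω => multiEval X p.1 p.2) :
    ∃ C, 0 ≤ C ∧ ∀ s : E ι, (∀ k, 0 ≤ s k) →
      ∫ ω, min (‖pair s (multiEval X s ω)‖ ^ 2) 1 ∂P ≤ C * min ‖s‖ 1 := by
  obtain ⟨C, hC0, hC⟩ := hX.exists_integral_min_sq_le hXm
  refine ⟨1 + Fintype.card ι * C, by positivity, fun s hs => ?_⟩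
  have hms : Measurable (multiEval X s) := Measurable.of_uncurry_left (f := multiEval X) hm
  have hmk : ∀ k, Measurable fun ω => multiEval X s ω k := fun k => by fun_prop
  have hik : ∀ k, Integrable (fun ω => min ((multiEval X s ω k) ^ 2) 1) P := fun k => by
    refine Integrable.of_bound (C := 1) (by fun_prop) (ae_of_all _ fun ω => ?_)
    rw [Real.norm_of_nonneg (by positivity)]
    exact min_le_right _ _
  rw [mul_min_of_nonneg _ _ (by positivity)]
  refine le_min ?_ ?_
  · rcases le_total 1 ‖s‖ with h1 | h1
    · have h2 : ∫ ω, min (‖pair s (multiEval X s ω)‖ ^ 2) 1 ∂P ≤ 1 := by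
        refine (integral_mono_of_nonneg (ae_of_all _ fun ω => by positivity)
          (integrable_const 1) (ae_of_all _ fun ω => min_le_right _ _)).trans (by simp)
      have : 0 ≤ Fintype.card ι * C := by positivity
      nlinarith
    have hpt : ∀ ω, min (‖pair s (multiEval X s ω)‖ ^ 2) 1
        ≤ ‖s‖ ^ 2 + ∑ k, min ((multiEval X s ω k) ^ 2) 1 := by
      intro ω
      rw [norm_pair_sq, EuclideanSpace.norm_sq_eq (multiEval X s ω)]
      simp only [Real.norm_eq_abs, sq_abs]
      by_cases hall : ∀ k, (multiEval X s ω k) ^ 2 ≤ 1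
      · rw [Finset.sum_congr rfl fun k _ => min_eq_left (hall k)]
        exact min_le_left _ _
      · push Not at hall
        obtain ⟨k, hk⟩ := hall
        refine (min_le_right _ _).trans ?_
        have h3 := Finset.single_le_sum (f := fun k => min ((multiEval X s ω k) ^ 2) 1)
          (fun k _ => by positivity) (Finset.mem_univ k)
        simp only [min_eq_right hk.le] at h3
        nlinarith [sq_nonneg ‖s‖]
    calc ∫ ω, min (‖pair s (multiEval X s ω)‖ ^ 2) 1 ∂P
        ≤ ∫ ω, (‖s‖ ^ 2 + ∑ k, min ((multiEval X s ω k) ^ 2) 1) ∂P :=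
          integral_mono_of_nonneg (ae_of_all _ fun ω => by positivity)
            ((integrable_const _).add (integrable_finsetSum _ fun k _ => hik k))
            (ae_of_all _ hpt)
      _ = ‖s‖ ^ 2 + ∑ k, ∫ ω, min ((multiEval X s ω k) ^ 2) 1 ∂P := by
          rw [integral_add (integrable_const _) (integrable_finsetSum _ fun k _ => hik k),
            integral_finsetSum _ fun k _ => hik k]
          simp
      _ ≤ ‖s‖ ^ 2 + ∑ _k : ι, C * ‖s‖ := by
          gcongr with k
          refine (hC k (s k).toNNReal).trans ?_
          rw [Real.coe_toNNReal _ (hs k)]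
          gcongr
          exact (le_abs_self _).trans (abs_apply_le_norm s k)
      _ ≤ (1 + Fintype.card ι * C) * ‖s‖ := by
          rw [Finset.sum_const, Finset.card_univ, nsmul_eq_mul]
          nlinarith [norm_nonneg s]
  · refine (integral_mono_of_nonneg (ae_of_all _ fun ω => by positivity)
      (integrable_const 1) (ae_of_all _ fun ω => min_le_right _ _)).trans ?_
    have : 0 ≤ Fintype.card ι * C := by positivity
    simpa using this

lemma integrable_min_norm_pair_sq (hm : Measurable fun p : E ι × Ω => multiEval X p.1 p.2)
    (s : E ι) : Integrable (fun ω => min (‖pair s (multiEval X s ω)‖ ^ 2) 1) P := by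
  have hms : Measurable (multiEval X s) := Measurable.of_uncurry_left (f := multiEval X) hm
  have h : Measurable fun ω => pair s (multiEval X s ω) := Measurable.pair measurable_const hms
  refine Integrable.of_bound (C := 1)
    ((h.norm.pow_const 2).min measurable_const).aestronglyMeasurable (ae_of_all _ fun ω => ?_)
  rw [Real.norm_of_nonneg (by positivity)]
  exact min_le_right _ _

lemma integrable_truncatedEval (hm : Measurable fun p : E ι × Ω => multiEval X p.1 p.2)
    (s : E ι) : Integrable (truncatedEval X s) P := by
  have hmt : Measurable (truncatedEval X s) :=
    Measurable.of_uncurry_left (f := truncatedEval X) (measurable_truncatedEval hm)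
  exact Integrable.of_bound hmt.aestronglyMeasurable 1
    (ae_of_all _ (norm_truncatedEval_le_one s))

/-- The truncation differs from the bounded smooth truncation `sin` by a quantity controlled by the
truncated second moment. -/
lemma abs_integral_truncatedEval_apply_le
    (hm : Measurable fun p : E ι × Ω => multiEval X p.1 p.2) (s : E ι) (k : ι) :
    |(∫ ω, truncatedEval X s ω ∂P) k| ≤ |∫ ω, Real.sin (multiEval X s ω k) ∂P|
      + 3 * ∫ ω, min (‖pair s (multiEval X s ω)‖ ^ 2) 1 ∂P := by
  have hms : Measurable (multiEval X s) := Measurable.of_uncurry_left (f := multiEval X) hm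
  have hmk : Measurable fun ω => multiEval X s ω k := hms.euclidean_apply k
  have hit : Integrable (truncatedEval X s) P := integrable_truncatedEval hm s
  have hitk : Integrable (fun ω => truncatedEval X s ω k) P :=
    (EuclideanSpace.proj (𝕜 := ℝ) k).integrable_comp hit
  have hsin : Integrable (fun ω => Real.sin (multiEval X s ω k)) P :=
    Integrable.of_bound (C := 1) (Real.measurable_sin.comp hmk).aestronglyMeasurable
      (ae_of_all _ fun ω => Real.abs_sin_le_one _)
  have hcoord : (∫ ω, truncatedEval X s ω ∂P) k = ∫ ω, truncatedEval X s ω k ∂P :=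
    ((EuclideanSpace.proj (𝕜 := ℝ) k).integral_comp_comm hit).symm
  have h3 : |∫ ω, (truncatedEval X s ω k - Real.sin (multiEval X s ω k)) ∂P|
      ≤ 3 * ∫ ω, min (‖pair s (multiEval X s ω)‖ ^ 2) 1 ∂P := by
    refine (norm_integral_le_of_norm_le ((integrable_min_norm_pair_sq hm s).const_mul 3)
      (f := fun ω => truncatedEval X s ω k - Real.sin (multiEval X s ω k))
      (ae_of_all _ fun ω => abs_truncatedEval_sub_sin_le s ω k)).trans ?_
    rw [integral_const_mul]
  rw [integral_sub hitk hsin] at h3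
  rw [hcoord]
  have h4 := abs_add_le (∫ ω, truncatedEval X s ω k ∂P - ∫ ω, Real.sin (multiEval X s ω k) ∂P)
    (∫ ω, Real.sin (multiEval X s ω k) ∂P)
  rw [sub_add_cancel] at h4
  linarith

lemma HasTriplet.exists_norm_integral_truncatedEval_le (hX : HasTriplet X P μ S ν)
    (hXm : ∀ t, Measurable (X t)) (hm : Measurable fun p : E ι × Ω => multiEval X p.1 p.2) :
    ∃ C, ∀ s : E ι, (∀ k, 0 ≤ s k) → ‖∫ ω, truncatedEval X s ω ∂P‖ ≤ C * min ‖s‖ 1 := by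
  obtain ⟨C, hC0, hC⟩ := hX.exists_abs_integral_sin_le hXm
  obtain ⟨D, hD0, hD⟩ := hX.exists_integral_min_norm_pair_le hXm hm
  refine ⟨1 + Fintype.card ι * (C + 3 * D), fun s hs => ?_⟩
  have hone : ‖∫ ω, truncatedEval X s ω ∂P‖ ≤ 1 :=
    (norm_integral_le_of_norm_le_const
      (ae_of_all _ (norm_truncatedEval_le_one (X := X) s))).trans (by simp)
  have hnn : 0 ≤ Fintype.card ι * (C + 3 * D) := by positivity
  rcases le_total 1 ‖s‖ with h1 | h1
  · rw [min_eq_right h1]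
    linarith
  have hDs := hD s hs
  rw [min_eq_left h1] at hDs ⊢
  have hk : ∀ k, |(∫ ω, truncatedEval X s ω ∂P) k| ≤ (C + 3 * D) * ‖s‖ := by
    intro k
    have h2 : |∫ ω, Real.sin (multiEval X s ω k) ∂P| ≤ C * ‖s‖ := by
      refine (hC k (s k).toNNReal).trans ?_
      rw [Real.coe_toNNReal _ (hs k)]
      exact mul_le_mul_of_nonneg_left ((le_abs_self _).trans (abs_apply_le_norm s k)) hC0
    have h3 := abs_integral_truncatedEval_apply_le (P := P) hm s k
    linarith
  refine (norm_le_sum_abs_apply _).trans ((Finset.sum_le_sum fun k _ => hk k).trans ?_)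
  rw [Finset.sum_const, Finset.card_univ, nsmul_eq_mul]
  linarith [norm_nonneg s]

end Moments

/-! ### The weak triplet -/

section PairLaw

lemma measurable_pair_multiEval {ι Ω : Type*} {mΩ : MeasurableSpace Ω} {X : ℝ≥0 → Ω → E ι}
    (hm : Measurable fun p : E ι × Ω => multiEval X p.1 p.2) (t : E ι) :
    Measurable fun ω => pair t (multiEval X t ω) :=
  Measurable.pair measurable_const (Measurable.of_uncurry_left (f := multiEval X) hm)

variable {ι Ω : Type*} [Fintype ι] {mΩ : MeasurableSpace Ω} {P : Measure Ω}
  {X T : ℝ≥0 → Ω → E ι} {d : E ι} {τ : Measure (E ι)}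

lemma IsSubordinator.restrict_puncturedOrthant (hT : IsSubordinator T P d τ) :
    τ.restrict (puncturedOrthant ι) = τ := by
  refine Measure.restrict_eq_self_of_ae_mem ?_
  have h0 : ∀ᵐ s ∂τ, s ≠ 0 := by
    rw [ae_iff]
    simpa using hT.triplet.levyMeasure.zero
  filter_upwards [hT.ae_nonneg_levyMeasure, h0] with s h1 h2 using ⟨h1, h2⟩

lemma integral_pairLaw {F : Type*} [NormedAddCommGroup F] [NormedSpace ℝ F]
    (hm : Measurable fun p : E ι × Ω => multiEval X p.1 p.2) (t : E ι) {f : E (ι ⊕ ι) → F}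
    (hf : StronglyMeasurable f) :
    ∫ z, f z ∂(pairLaw X P t) = ∫ ω, f (pair t (multiEval X t ω)) ∂P :=
  integral_map (measurable_pair_multiEval hm t).aemeasurable hf.aestronglyMeasurable

variable [IsProbabilityMeasure P]

lemma measurable_pairLaw (hm : Measurable fun p : E ι × Ω => multiEval X p.1 p.2) :
    Measurable (pairLaw X P) := by
  have hpm : Measurable fun p : E ι × Ω => pair p.1 (multiEval X p.1 p.2) :=
    Measurable.pair measurable_fst hm
  refine Measure.measurable_of_measurable_coe _ fun s hs => ?_
  have h1 : ∀ t, pairLaw X P t s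
      = P (Prod.mk t ⁻¹' ((fun p : E ι × Ω => pair p.1 (multiEval X p.1 p.2)) ⁻¹' s)) := by
    intro t
    have : Measurable fun ω => pair t (multiEval X t ω) :=
      Measurable.of_uncurry_left (f := fun t ω => pair t (multiEval X t ω)) hpm
    rw [pairLaw, Measure.map_apply this hs]
    rfl
  simp_rw [h1]
  exact measurable_measure_prodMk_left (hpm hs)

/-- The law of `(t, X(t))` as a Markov kernel in the multivariate time `t`. -/
def pairKernel (hm : Measurable fun p : E ι × Ω => multiEval X p.1 p.2) :
    Kernel (E ι) (E (ι ⊕ ι)) :=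
  ⟨pairLaw X P, measurable_pairLaw hm⟩

instance (hm : Measurable fun p : E ι × Ω => multiEval X p.1 p.2) :
    IsMarkovKernel (pairKernel (P := P) hm) :=
  ⟨fun t => Measure.isProbabilityMeasure_map (measurable_pair_multiEval hm t).aemeasurable⟩

lemma integrable_min_bind_pairLaw (hT : IsSubordinator T P d τ) {μ : E ι} {S : Matrix ι ι ℝ}
    {ν : Measure (E ι)} (hX : HasTriplet X P μ S ν) (hXm : ∀ t, Measurable (X t))
    (hm : Measurable fun p : E ι × Ω => multiEval X p.1 p.2) :
    Integrable (fun z => min (‖z‖ ^ 2) 1) (τ.bind (pairLaw X P)) := by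
  obtain ⟨C, hC0, hC⟩ := hX.exists_integral_min_norm_pair_le hXm hm
  have hf : Measurable fun z : E (ι ⊕ ι) => min (‖z‖ ^ 2) 1 := by fun_prop
  have hfn : StronglyMeasurable fun z : E (ι ⊕ ι) => ‖min (‖z‖ ^ 2) 1‖ :=
    hf.norm.stronglyMeasurable
  refine (Measure.integrable_comp_iff (κ := pairKernel (P := P) hm)
    hf.aestronglyMeasurable).2 ⟨ae_of_all _ fun t => ?_, ?_⟩
  · refine Integrable.of_bound (C := 1) hf.aestronglyMeasurable (ae_of_all _ fun z => ?_)
    rw [Real.norm_of_nonneg (by positivity)]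
    exact min_le_right _ _
  · refine (hT.integrable_min_norm.const_mul C).mono'
      hfn.integral_kernel.aestronglyMeasurable ?_
    filter_upwards [hT.ae_nonneg_levyMeasure] with s hs
    have h1 : ∫ z, ‖min (‖z‖ ^ 2) 1‖ ∂(pairKernel (P := P) hm s)
        = ∫ ω, min (‖pair s (multiEval X s ω)‖ ^ 2) 1 ∂P := by
      refine (integral_pairLaw hm s hfn).trans (integral_congr_ae (ae_of_all _ fun ω => ?_))
      exact Real.norm_of_nonneg (by positivity)
    rw [h1, Real.norm_of_nonneg (integral_nonneg fun ω => by positivity)]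
    exact hC s hs

lemma isLevyMeasure_bind_pairLaw (hT : IsSubordinator T P d τ) {μ : E ι} {S : Matrix ι ι ℝ}
    {ν : Measure (E ι)} (hX : HasTriplet X P μ S ν) (hXm : ∀ t, Measurable (X t))
    (hm : Measurable fun p : E ι × Ω => multiEval X p.1 p.2) :
    IsLevyMeasure (τ.bind (pairLaw X P)) := by
  refine IsLevyMeasure.of_integrable ?_ (integrable_min_bind_pairLaw hT hX hXm hm)
  rw [Measure.bind_apply (measurableSet_singleton 0) (measurable_pairLaw hm).aemeasurable]
  have h0 : ∀ᵐ s ∂τ, s ≠ 0 := by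
    rw [ae_iff]
    simpa using hT.triplet.levyMeasure.zero
  refine (lintegral_congr_ae ?_).trans lintegral_zero
  filter_upwards [h0] with s hs
  rw [pairLaw, Measure.map_apply (measurable_pair_multiEval hm s) (measurableSet_singleton 0)]
  have : (fun ω => pair s (multiEval X s ω)) ⁻¹' {0} = ∅ := by
    ext ω
    simp only [Set.mem_preimage, Set.mem_singleton_iff, Set.mem_empty_iff_false, iff_false]
    exact fun h => hs (left_eq_zero_of_pair_eq_zero h)
  simp [this]

/-- The mean jump in time, truncated to the jumps of `(t, X(t))` that stay in the unit ball, is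
integrable because no such jump has `‖t‖ > 1`. -/
lemma integrable_truncatedTime (hT : IsSubordinator T P d τ)
    (hm : Measurable fun p : E ι × Ω => multiEval X p.1 p.2) :
    Integrable (fun t => (pairLaw X P t).real (unitBall (ι ⊕ ι)) • t) τ := by
  have h1 : Measurable fun t => (pairLaw X P t).real (unitBall (ι ⊕ ι)) :=
    ((Measure.measurable_coe measurableSet_unitBall).comp (measurable_pairLaw hm)).ennreal_toReal
  refine hT.integrable_min_norm.mono' (h1.smul measurable_id).aestronglyMeasurable
    (ae_of_all _ fun t => ?_)
  have hprob : IsProbabilityMeasure (pairLaw X P t) :=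
    Measure.isProbabilityMeasure_map (measurable_pair_multiEval hm t).aemeasurable
  rw [norm_smul, Real.norm_of_nonneg measureReal_nonneg]
  rcases le_or_gt ‖t‖ 1 with h | h
  · rw [min_eq_left h]
    exact mul_le_of_le_one_left (norm_nonneg _) measureReal_le_one
  · have h2 : (pairLaw X P t).real (unitBall (ι ⊕ ι)) = 0 := by
      rw [measureReal_def, pairLaw,
        Measure.map_apply (measurable_pair_multiEval hm t) measurableSet_unitBall]
      have : (fun ω => pair t (multiEval X t ω)) ⁻¹' unitBall (ι ⊕ ι) = ∅ := by
        ext ω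
        simp only [Set.mem_preimage, Set.mem_empty_iff_false, iff_false]
        exact fun hω => absurd ((norm_left_le_norm_pair t _).trans hω) (not_le.2 h)
      simp [this]
    rw [h2, zero_mul]
    positivity

lemma integrable_truncatedSpace (hT : IsSubordinator T P d τ) {μ : E ι} {S : Matrix ι ι ℝ}
    {ν : Measure (E ι)} (hX : HasTriplet X P μ S ν) (hXm : ∀ t, Measurable (X t))
    (hm : Measurable fun p : E ι × Ω => multiEval X p.1 p.2) :
    Integrable (fun t => ∫ ω, truncatedEval X t ω ∂P) τ := by
  obtain ⟨C, hC⟩ := hX.exists_norm_integral_truncatedEval_le hXm hm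
  have h1 : StronglyMeasurable fun t => ∫ ω, truncatedEval X t ω ∂P :=
    (measurable_truncatedEval hm).stronglyMeasurable.integral_prod_right'
  exact (hT.integrable_min_norm.const_mul C).mono' h1.aestronglyMeasurable
    (hT.ae_nonneg_levyMeasure.mono fun s hs => hC s hs)

lemma integral_levyIntegrand_pair (hm : Measurable fun p : E ι × Ω => multiEval X p.1 p.2)
    (θ : E (ι ⊕ ι)) (t : E ι) :
    ∫ ω, levyIntegrand θ (pair t (multiEval X t ω)) ∂P
      = ∫ ω, Complex.exp (Complex.I * (inner ℝ θ (pair t (multiEval X t ω)) : ℝ)) ∂P - 1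
        - Complex.I * ((inner ℝ (timePart θ)
            ((pairLaw X P t).real (unitBall (ι ⊕ ι)) • t)
          + inner ℝ (spacePart θ) (∫ ω, truncatedEval X t ω ∂P) : ℝ) : ℂ) := by
  have hpm := measurable_pair_multiEval hm t
  set D : Set Ω := (fun ω => pair t (multiEval X t ω)) ⁻¹' unitBall (ι ⊕ ι) with hD
  have hDm : MeasurableSet D := hpm measurableSet_unitBall
  have hpt : ∀ ω, levyIntegrand θ (pair t (multiEval X t ω))
      = Complex.exp (Complex.I * (inner ℝ θ (pair t (multiEval X t ω)) : ℝ)) - 1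
        - Complex.I * ((D.indicator (fun _ => (inner ℝ (timePart θ) t : ℝ)) ω
          + inner ℝ (spacePart θ) (truncatedEval X t ω) : ℝ) : ℂ) := by
    intro ω
    unfold levyIntegrand
    congr 3
    by_cases h : pair t (multiEval X t ω) ∈ unitBall (ι ⊕ ι)
    · have h' : ω ∈ D := h
      rw [Set.indicator_of_mem h, Set.indicator_of_mem h', truncatedEval_of_mem h, inner_pair]
    · have h' : ω ∉ D := h
      rw [Set.indicator_of_notMem h, Set.indicator_of_notMem h', truncatedEval_of_notMem h]
      simp
  have hexp : Integrable (fun ω =>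
      Complex.exp (Complex.I * (inner ℝ θ (pair t (multiEval X t ω)) : ℝ))) P := by
    have h1 : Measurable fun z : E (ι ⊕ ι) => Complex.exp (Complex.I * (inner ℝ θ z : ℝ)) := by
      fun_prop
    exact Integrable.of_bound (h1.comp hpm).aestronglyMeasurable 1
      (ae_of_all _ fun ω => norm_exp_I_mul_ofReal_le_one _)
  have hind : Integrable (D.indicator (fun _ => (inner ℝ (timePart θ) t : ℝ))) P :=
    (integrable_const _).indicator hDm
  have htr : Integrable (fun ω => (inner ℝ (spacePart θ) (truncatedEval X t ω) : ℝ)) P :=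
    (integrable_truncatedEval hm t).const_inner _
  have hreal : ((pairLaw X P t).real (unitBall (ι ⊕ ι))) = P.real D :=
    map_measureReal_apply hpm measurableSet_unitBall
  have hexp1 : Integrable (fun ω =>
      Complex.exp (Complex.I * (inner ℝ θ (pair t (multiEval X t ω)) : ℝ)) - 1) P :=
    hexp.sub (integrable_const 1)
  have hsum : Integrable (fun ω => Complex.I * ((D.indicator (fun _ => inner ℝ (timePart θ) t) ω
      + inner ℝ (spacePart θ) (truncatedEval X t ω) : ℝ) : ℂ)) P :=
    (hind.add htr).ofReal.const_mul _
  rw [integral_congr_ae (ae_of_all _ hpt), integral_sub hexp1 hsum,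
    integral_sub hexp (integrable_const 1), integral_const_mul]
  congr 2
  · simp
  · rw [integral_complex_ofReal, integral_add hind htr, integral_indicator_const _ hDm,
      integral_inner (integrable_truncatedEval hm t), hreal, inner_smul_right, smul_eq_mul]

lemma integral_bind_pairLaw (hT : IsSubordinator T P d τ) {μ : E ι} {S : Matrix ι ι ℝ}
    {ν : Measure (E ι)} (hX : HasTriplet X P μ S ν) (hXm : ∀ t, Measurable (X t))
    (hm : Measurable fun p : E ι × Ω => multiEval X p.1 p.2) (θ : E (ι ⊕ ι)) :
    Integrable (fun t => ∫ ω, levyIntegrand θ (pair t (multiEval X t ω)) ∂P) τ ∧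
    ∫ z, levyIntegrand θ z ∂(τ.bind (pairLaw X P))
      = ∫ t, ∫ ω, levyIntegrand θ (pair t (multiEval X t ω)) ∂P ∂τ := by
  have hint : Integrable (levyIntegrand θ) (τ.bind (pairLaw X P)) :=
    (isLevyMeasure_bind_pairLaw hT hX hXm hm).integrable_levyIntegrand θ
  have hcomp : τ.bind (pairLaw X P)
      = ((pairKernel (P := P) hm) ∘ₖ Kernel.const Unit τ) () := by
    rw [← Measure.comp_eq_comp_const_apply]
    rfl
  have hpl : ∀ t, ∫ z, levyIntegrand θ z ∂(pairKernel (P := P) hm t)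
      = ∫ ω, levyIntegrand θ (pair t (multiEval X t ω)) ∂P := fun t =>
    integral_pairLaw hm t (measurable_levyIntegrand θ).stronglyMeasurable
  rw [hcomp] at hint ⊢
  refine ⟨?_, ?_⟩
  · have h1 := hint.integral_comp
    rw [Kernel.const_apply] at h1
    simpa only [hpl] using h1
  · rw [Kernel.integral_comp hint, Kernel.const_apply]
    simp only [hpl]

end PairLaw

section WeakTriplet

variable {n : ℕ} {Ω : Type*} {mΩ : MeasurableSpace Ω} {P : Measure Ω}
  {X T : ℝ≥0 → Ω → E (Fin n)} {d μ : E (Fin n)} {S : Matrix (Fin n) (Fin n) ℝ}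
  {τ ν : Measure (E (Fin n))} {A : Set (E (Fin n))} {u : E (Fin n) → Fin n → ℂ}

lemma levyIntegrand_pair_zero {ι : Type*} [Fintype ι] (θ : E (ι ⊕ ι)) (x : E ι) :
    levyIntegrand θ (pair 0 x) = levyIntegrand (spacePart θ) x := by
  unfold levyIntegrand
  have h1 : (inner ℝ θ (pair 0 x) : ℝ) = inner ℝ (spacePart θ) x := by
    rw [inner_pair, inner_zero_right, zero_add]
  have h2 : pair 0 x ∈ unitBall (ι ⊕ ι) ↔ x ∈ unitBall ι := by
    simp only [unitBall, Set.mem_ofPred_eq, norm_pair_zero]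
  by_cases hx : x ∈ unitBall ι
  · rw [Set.indicator_of_mem hx, Set.indicator_of_mem (h2.2 hx), h1]
  · rw [Set.indicator_of_notMem hx, Set.indicator_of_notMem (fun h => hx (h2.1 h)), h1]

lemma measurable_pair_zero {ι : Type*} : Measurable (pair (0 : E ι)) :=
  Measurable.pair measurable_const measurable_id

lemma isLevyMeasure_map_pair_zero {ι : Type*} [Fintype ι] {ρ : Measure (E ι)}
    (hρ : IsLevyMeasure ρ) : IsLevyMeasure (ρ.map (pair 0)) := by
  refine IsLevyMeasure.of_integrable ?_ ?_
  · rw [Measure.map_apply measurable_pair_zero (measurableSet_singleton 0)]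
    refine measure_mono_null (fun x hx => ?_) hρ.zero
    exact right_eq_zero_of_pair_eq_zero hx
  · rw [integrable_map_measure (by fun_prop) measurable_pair_zero.aemeasurable]
    simpa only [Function.comp_def, norm_pair_zero] using hρ.integrable_min

lemma IsLevyMeasure.add {ι : Type*} [Fintype ι] {ρ₁ ρ₂ : Measure (E ι)} (h₁ : IsLevyMeasure ρ₁)
    (h₂ : IsLevyMeasure ρ₂) : IsLevyMeasure (ρ₁ + ρ₂) :=
  IsLevyMeasure.of_integrable (by simp [h₁.zero, h₂.zero])
    (h₁.integrable_min.add_measure h₂.integrable_min)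

lemma posSemidef_fromBlocks_zero {ι : Type*} [Fintype ι] [DecidableEq ι] {D : Matrix ι ι ℝ}
    (hD : D.PosSemidef) : (Matrix.fromBlocks (0 : Matrix ι ι ℝ) 0 0 D).PosSemidef := by
  have h := hD.mul_mul_conjTranspose_same (Matrix.fromRows (0 : Matrix ι ι ℝ) (1 : Matrix ι ι ℝ))
  rwa [Matrix.fromRows_mul, Matrix.conjTranspose_fromRows_eq_fromCols_conjTranspose,
    Matrix.fromRows_mul_fromCols, Matrix.conjTranspose_zero, Matrix.conjTranspose_one,
    Matrix.zero_mul, Matrix.zero_mul, Matrix.zero_mul, Matrix.mul_zero, Matrix.one_mul,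
    Matrix.mul_one] at h

variable [IsProbabilityMeasure P]

/-- The exponent of the pair is the Lévy exponent of the weak triplet. -/
lemma IsLinearTimeChange.levyExponent_weak (h : IsLinearTimeChange X T P d τ A u)
    (hX : HasTriplet X P μ S ν) (hτ : ∀ᵐ s ∂τ, s ∈ A)
    (hd : ∀ θ, ∑ k, u θ k * d k
      = ∑ j, (spacing d j : ℂ) * levyExponent μ S ν (proj (upper d j) θ))
    (θ : E (Fin n ⊕ Fin n)) :
    levyExponent (pair (weakMeanTime X P d τ) (weakMeanSpace X P μ ν d τ))
      (Matrix.fromBlocks 0 0 0 (diamondMat d S)) (weakLevyMeasure X P ν d τ) θ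
      = pairExponent u d τ θ := by
  have hT := h.subordinator
  have hm := h.measurable_multiEval
  have hXm := h.measurable_process
  obtain ⟨hint, hbind⟩ := integral_bind_pairLaw hT hX hXm hm θ
  have ht := integrable_truncatedTime (X := X) hT hm
  have hs := integrable_truncatedSpace hT hX hXm hm
  have hdl := isLevyMeasure_diamondMeasure d hX.levyMeasure
  have htr : Integrable (fun t => Complex.I * ((inner ℝ (timePart θ)
      ((pairLaw X P t).real (unitBall (Fin n ⊕ Fin n)) • t)
        + inner ℝ (spacePart θ) (∫ ω, truncatedEval X t ω ∂P) : ℝ) : ℂ)) τ :=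
    ((ht.const_inner _).add (hs.const_inner _)).ofReal.const_mul _
  have hjump : ∫ s, (Complex.exp (∑ k, pairCoeff u θ k * s k) - 1) ∂τ
      = ∫ z, levyIntegrand θ z ∂(τ.bind (pairLaw X P))
        + Complex.I * ((inner ℝ (timePart θ)
            (∫ t, (pairLaw X P t).real (unitBall (Fin n ⊕ Fin n)) • t ∂τ)
          + inner ℝ (spacePart θ) (∫ t, ∫ ω, truncatedEval X t ω ∂P ∂τ) : ℝ) : ℂ) := by
    rw [← integral_inner ht, ← integral_inner hs,
      ← integral_add (ht.const_inner _) (hs.const_inner _), ← integral_complex_ofReal,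
      ← integral_const_mul, hbind, ← integral_add hint htr]
    refine integral_congr_ae ?_
    filter_upwards [hτ] with s hsA
    rw [integral_levyIntegrand_pair hm θ s, h.integral_exp_pair hsA]
    ring
  have hmt : weakMeanTime X P d τ
      = d + ∫ t, (pairLaw X P t).real (unitBall (Fin n ⊕ Fin n)) • t ∂τ := by
    rw [weakMeanTime, hT.restrict_puncturedOrthant]
  have hms : weakMeanSpace X P μ ν d τ
      = compensation d ν + diamondVec d μ + ∫ t, ∫ ω, truncatedEval X t ω ∂P ∂τ := by
    rw [weakMeanSpace, hT.restrict_puncturedOrthant]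
    rfl
  have hquad : ∑ k, ∑ l, θ k * Matrix.fromBlocks 0 0 0 (diamondMat d S) k l * θ l
      = ∑ k, ∑ l, spacePart θ k * diamondMat d S k l * spacePart θ l := by
    simp [Fintype.sum_sum_type, spacePart]
  have hjmp : ∫ z, levyIntegrand θ z ∂(weakLevyMeasure X P ν d τ)
      = ∫ x, levyIntegrand (spacePart θ) x ∂(diamondMeasure d ν)
        + ∫ z, levyIntegrand θ z ∂(τ.bind (pairLaw X P)) := by
    rw [weakLevyMeasure, hT.restrict_puncturedOrthant,
      integral_add_measure ((isLevyMeasure_map_pair_zero hdl).integrable_levyIntegrand θ)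
        ((isLevyMeasure_bind_pairLaw hT hX hXm hm).integrable_levyIntegrand θ),
      integral_map measurable_pair_zero.aemeasurable (by fun_prop)]
    simp only [levyIntegrand_pair_zero]
  have hdrift := levyExponent_diamond hT.drift_nonneg μ S hX.levyMeasure (spacePart θ)
  rw [← hd, levyExponent_eq] at hdrift
  rw [pairExponent, sum_pairCoeff_mul, ← hdrift, hjump, levyExponent_eq, hjmp, hquad,
    real_inner_comm, inner_pair, hmt, hms, inner_add_right, inner_add_right,
    real_inner_comm (spacePart θ)]
  push_cast
  ring

/-- Under linearity of the exponent along the time change, `(T, X ∘ T)` has the weak triplet. -/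
lemma IsLinearTimeChange.isWeakSubordination (h : IsLinearTimeChange X T P d τ A u)
    (hX : HasTriplet X P μ S ν) (hτ : ∀ᵐ s ∂τ, s ∈ A)
    (hd : ∀ θ, ∑ k, u θ k * d k
      = ∑ j, (spacing d j : ℂ) * levyExponent μ S ν (proj (upper d j) θ)) :
    IsWeakSubordination (fun t ω => pair (T t ω) (subordinate X T t ω)) P X P μ S ν d τ := by
  have hT := h.subordinator
  refine ⟨h.isLevyProcess_pair.1,
    posSemidef_fromBlocks_zero (posSemidef_diamondMat hT.drift_nonneg hX.cov), ?_, fun t θ => ?_⟩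
  · rw [weakLevyMeasure, hT.restrict_puncturedOrthant]
    exact (isLevyMeasure_map_pair_zero (isLevyMeasure_diamondMeasure d hX.levyMeasure)).add
      (isLevyMeasure_bind_pairLaw hT hX h.measurable_process h.measurable_multiEval)
  · rw [h.levyExponent_weak hX hτ hd]
    exact h.isLevyProcess_pair.2 t θ

end WeakTriplet

/-! ### Passing to indistinguishable copies -/

section Congr

variable {n : ℕ} {Ω : Type*} {mΩ : MeasurableSpace Ω} {P : Measure Ω}
  {X X' T T' : ℝ≥0 → Ω → E (Fin n)} {d μ : E (Fin n)} {S : Matrix (Fin n) (Fin n) ℝ}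
  {τ ν : Measure (E (Fin n))}

lemma IsSubordinator.congr (hT : IsSubordinator T P d τ) (h : ∀ᵐ ω ∂P, ∀ t, T' t ω = T t ω) :
    IsSubordinator T' P d τ := by
  refine ⟨hT.triplet.congr h, hT.finiteVariation, ?_, hT.drift_nonneg, hT.orthant⟩
  filter_upwards [h, hT.nondecreasing] with ω h1 h2
  simpa only [h1] using h2

/-- The weak triplet only depends on the law of `X`, and being a Lévy process with this triplet
only depends on the pair up to indistinguishability. -/
lemma IsWeakSubordination.congr
    (h : IsWeakSubordination (fun t ω => pair (T' t ω) (subordinate X' T' t ω)) P X' P μ S ν d τ)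
    (hX : ∀ᵐ ω ∂P, ∀ t, X' t ω = X t ω) (hT : ∀ᵐ ω ∂P, ∀ t, T' t ω = T t ω) :
    IsWeakSubordination (fun t ω => pair (T t ω) (subordinate X T t ω)) P X P μ S ν d τ := by
  have heval : ∀ t, ∀ᵐ ω ∂P, multiEval X' t ω = multiEval X t ω := fun t => by
    filter_upwards [hX] with ω hω
    simp only [multiEval, hω]
  have hlaw : pairLaw X' P = pairLaw X P := by
    funext t
    exact Measure.map_congr ((heval t).mono fun ω hω => by simp only [hω])
  have htr : ∀ t, ∫ ω, truncatedEval X' t ω ∂P = ∫ ω, truncatedEval X t ω ∂P := fun t =>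
    integral_congr_ae ((heval t).mono fun ω hω => by
      by_cases hmem : pair t (multiEval X t ω) ∈ unitBall (Fin n ⊕ Fin n)
      · rw [truncatedEval_of_mem hmem, truncatedEval_of_mem (by rwa [hω]), hω]
      · rw [truncatedEval_of_notMem hmem, truncatedEval_of_notMem (by rwa [hω])])
  have h1 : weakMeanTime X' P d τ = weakMeanTime X P d τ := by
    simp only [weakMeanTime, hlaw]
  have h2 : weakMeanSpace X' P μ ν d τ = weakMeanSpace X P μ ν d τ := by
    have : ∀ Y : ℝ≥0 → Ω → E (Fin n), weakMeanSpace Y P μ ν d τ = compensation d ν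
        + diamondVec d μ + ∫ t in puncturedOrthant (Fin n), ∫ ω, truncatedEval Y t ω ∂P ∂τ :=
      fun Y => rfl
    rw [this, this]
    simp only [htr]
  have h3 : weakLevyMeasure X' P ν d τ = weakLevyMeasure X P ν d τ := by
    simp only [weakLevyMeasure, hlaw]
  unfold IsWeakSubordination at h ⊢
  rw [h1, h2, h3] at h
  refine h.congr ?_
  filter_upwards [hX, hT] with ω h4 h5 t
  simp only [subordinate, multiEval, h4, h5]

variable [IsProbabilityMeasure P]

/-- If `T` takes almost surely its values in a set of times on which the exponent of `X` is linear,
then `(T, X ∘ T)` has the weak triplet. -/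
lemma isWeakSubordination_of_hasLinearExponent (hT : IsSubordinator T P d τ)
    (hX : HasTriplet X P μ S ν)
    (hTX : IndepFun (fun ω (t : ℝ≥0) => T t ω) (fun ω (t : ℝ≥0) => X t ω) P)
    {A : Set (E (Fin n))} {u : E (Fin n) → Fin n → ℂ} (hA0 : 0 ∈ A)
    (hA : ∀ s ∈ A, ∀ k, 0 ≤ s k) (hTA : ∀ᵐ ω ∂P, ∀ t, T t ω ∈ A)
    (hu : ∀ θ k, (u θ k).re ≤ 0)
    (hlin : HasLinearExponent X P A u) (hτ : ∀ᵐ s ∂τ, s ∈ A)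
    (hd : ∀ θ, ∑ k, u θ k * d k
      = ∑ j, (spacing d j : ℂ) * levyExponent μ S ν (proj (upper d j) θ)) :
    IsWeakSubordination (fun t ω => pair (T t ω) (subordinate X T t ω)) P X P μ S ν d τ := by
  obtain ⟨X', hXm, hXC, hXX⟩ := exists_indistinguishable_cadlag hX.levy.aemeasurable
    (C := fun f => IsCadlagPath f ∧ f 0 = 0) ⟨isCadlagPath_zero, rfl⟩ (fun f hf => hf.1)
    (hX.levy.cadlag.and hX.levy.zero)
  obtain ⟨T', hTm, hTC, hTT⟩ := exists_indistinguishable_cadlag hT.triplet.levy.aemeasurable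
    (C := fun f => IsCadlagPath f ∧ f 0 = 0 ∧ (∀ k, Monotone fun t => f t k) ∧ ∀ t, f t ∈ A)
    ⟨isCadlagPath_zero, rfl, fun k => monotone_const, fun t => hA0⟩ (fun f hf => hf.1) (by
      filter_upwards [hT.triplet.levy.cadlag, hT.triplet.levy.zero, hT.nondecreasing, hTA]
        with ω h1 h2 h3 h4 using ⟨h1, h2, h3, h4⟩)
  have hlin' : HasLinearExponent X' P A u := by
    intro m s hs hmono θ
    rw [← hlin m s hs hmono θ]
    refine integral_congr_ae ?_
    filter_upwards [hXX] with ω hω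
    simp only [multiEval, hω]
  have hind : IndepFun (fun ω (t : ℝ≥0) => T' t ω) (fun ω (t : ℝ≥0) => X' t ω) P :=
    hTX.congr (hTT.mono fun ω hω => (funext hω).symm) (hXX.mono fun ω hω => (funext hω).symm)
  have hmain : IsLinearTimeChange X' T' P d τ A u :=
    { measurable_process := hXm
      cadlag_process := fun ω => (hXC ω).1
      process_zero := fun ω => (hXC ω).2
      subordinator := hT.congr hTT
      measurable_time := hTm
      cadlag_time := fun ω => (hTC ω).1
      monotone_time := fun ω => (hTC ω).2.2.1
      time_zero := fun ω => (hTC ω).2.1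
      time_mem := fun ω => (hTC ω).2.2.2
      nonneg_of_mem := hA
      indep := hind
      linear := hlin'
      re_nonpos := hu }
  exact (hmain.isWeakSubordination (hX.congr hXX) hτ hd).congr hXX hTT

lemma isWeakSubordination_of_hasIndependentComponents (hT : IsSubordinator T P d τ)
    (hX : HasTriplet X P μ S ν)
    (hTX : IndepFun (fun ω (t : ℝ≥0) => T t ω) (fun ω (t : ℝ≥0) => X t ω) P)
    (h : HasIndependentComponents X P) :
    IsWeakSubordination (fun t ω => pair (T t ω) (subordinate X T t ω)) P X P μ S ν d τ := by
  refine isWeakSubordination_of_hasLinearExponent hT hX hTX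
    (A := {s | ∀ k, 0 ≤ s k}) (fun k => le_rfl) (fun s hs => hs) ?_
    (fun θ k => hX.levyExponent_re_nonpos _) (hX.hasLinearExponent_orthant h)
    hT.ae_nonneg_levyMeasure (levyExponent_orthant_drift hX h d)
  filter_upwards [hT.nondecreasing, hT.triplet.levy.zero] with ω h1 h2 t k
  have := h1 k (zero_le : (0 : ℝ≥0) ≤ t)
  simpa [h2] using this

lemma isWeakSubordination_of_hasIndistinguishableComponents [NeZero n]
    (hT : IsSubordinator T P d τ) (hX : HasTriplet X P μ S ν)
    (hTX : IndepFun (fun ω (t : ℝ≥0) => T t ω) (fun ω (t : ℝ≥0) => X t ω) P)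
    (h : HasIndistinguishableComponents T P) :
    IsWeakSubordination (fun t ω => pair (T t ω) (subordinate X T t ω)) P X P μ S ν d τ := by
  obtain ⟨hd, hτ⟩ := hT.diagonal h
  refine isWeakSubordination_of_hasLinearExponent hT hX hTX
    (A := diagonalTimes (Fin n)) (by simp [diagonalTimes]) (fun s hs => hs.1) ?_
    (fun θ k => ?_) hX.hasLinearExponent_diagonal hτ (levyExponent_diagonal_drift hd)
  · filter_upwards [hT.nondecreasing, hT.triplet.levy.zero, h] with ω h1 h2 h3 t
    refine ⟨fun k => ?_, h3 t⟩
    have := h1 k (zero_le : (0 : ℝ≥0) ≤ t)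
    simpa [h2] using this
  · have h1 := hX.levyExponent_re_nonpos θ
    rw [← Complex.ofReal_natCast, Complex.div_ofReal_re]
    exact div_nonpos_of_nonpos_of_nonneg h1 (Nat.cast_nonneg _)

end Congr

end

end WeakSubordination

open WeakSubordination in
/-- If the subordinator `T` and the Lévy process `X` are independent, and `T` has indistinguishable
components or `X` has independent components, then `(T, X ∘ T)` is `T` subordinating `X` in the
semi-strong sense. -/
theorem proposition3p3 {n : ℕ} {Ω : Type*} {mΩ : MeasurableSpace Ω} (P : Measure Ω)
    [IsProbabilityMeasure P]
    (T X : ℝ≥0 → Ω → EuclideanSpace ℝ (Fin n))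
    (d : EuclideanSpace ℝ (Fin n)) (τ : Measure (EuclideanSpace ℝ (Fin n)))
    (μ : EuclideanSpace ℝ (Fin n)) (S : Matrix (Fin n) (Fin n) ℝ)
    (ν : Measure (EuclideanSpace ℝ (Fin n)))
    (hT : IsSubordinator T P d τ)
    (hX : HasTriplet X P μ S ν)
    (hTX : IndepFun (fun ω (t : ℝ≥0) => T t ω) (fun ω (t : ℝ≥0) => X t ω) P)
    (h : HasIndistinguishableComponents T P ∨ HasIndependentComponents X P) :
    IsSemiStrongSubordination (fun t ω => pair (T t ω) (subordinate X T t ω)) T P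
      X P μ S ν d τ := by
  refine ⟨ae_of_all _ fun ω t k => rfl, ?_⟩
  rcases h with h | h
  · rcases Nat.eq_zero_or_pos n with rfl | hn
    -- in dimension `0` there is no component, so that the second case applies
    · exact isWeakSubordination_of_hasIndependentComponents hT hX hTX iIndepFun.of_subsingleton
    · have : NeZero n := ⟨hn.ne'⟩
      exact isWeakSubordination_of_hasIndistinguishableComponents hT hX hTX h
  · exact isWeakSubordination_of_hasIndependentComponents hT hX hTX h
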